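/- Let $\Omega$ be a Riemann surface (a connected Hausdorff one-dimensional complex manifold) and let $a\in\Omega$. Let $R=H^\infty(\Omega)$ be the algebra of bounded analytic functions on $\Omega$, and let $\mathcal H=H^2(\Omega)$ be the space of analytic functions $h:\Omega\to\mathbb C$ such that $|h|^2$ has a harmonic majorant on $\Omega$. For an analytic function $f$ on $\Omega$ let $\operatorname{ord}(f)\in\{0,1,2,\dots\}\cup\{\infty\}$ be the order of the zero of $f$ at $a$, computed in a local coordinate. Put $R_1=\{r\in R:\operatorname{ord}(r)\ge1\}$. Then for every $h\in\mathcal H$ the function $|h|^2$ has a least harmonic majorant $u_h$, and there is an inner product on $\mathcal H$ whose norm is given by $\|h\|^2=u_h(a)$. With this inner product, $\mathcal H$ is an analytic Hilbert module over the analytic algebra $R$. This means: (i) $\operatorname{ord}$ is an analytic valuation on $R$: for $r,s\in R$ and $0\ne\lambda\in\mathbb C$, $\operatorname{ord}(r)=0$ if $r$ has a one-sided inverse, $\operatorname{ord}(r)=\infty$ if and only if $r=0$, $\operatorname{ord}(rs)\ge\operatorname{ord}(r)+\operatorname{ord}(s)$, $\operatorname{ord}(\lambda r)=\operatorname{ord}(r)$,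 and $\operatorname{ord}(r+s)\ge\min(\operatorname{ord}(r),\operatorname{ord}(s))$; (ii) $\mathcal H$ is a Hilbert space (in particular complete) and, under pointwise operations, an $R$-module on which each map $h\mapsto rh$ ($r\in R$) is continuous; (iii) $\operatorname{ord}$ is a Hilbert module valuation on $\mathcal H$: for $r\in R$, $g,h\in\mathcal H$ and $0\ne\lambda\in\mathbb C$, $\operatorname{ord}(h)=\infty$ if and only if $h=0$, $\operatorname{ord}(rh)\ge\operatorname{ord}(r)+\operatorname{ord}(h)$, $\operatorname{ord}(\lambda h)=\operatorname{ord}(h)$, $\operatorname{ord}(g+h)\ge\min(\operatorname{ord}(g),\operatorname{ord}(h))$, and $\operatorname{ord}$ is upper semicontinuous on $\mathcal H$ for the norm topology; (iv) there is an open neighborhood $\Omega_a$ of $a$ such that every sequence converging in the norm of $\mathcal H$ converges, to the same limit, uniformly on the compact subsets of $\Omega_a$. Moreover $R$ is unital, that is, $R=\mathbb C\,1+R_1$, and the closed invariant subspaces of $\mathcal H$ are described as follows. For a closed subspace $V$ of $\mathcal H$ and $k\ge0$ let $V_k=\{h\in V:\operatorname{ord}(h)\ge k\}$ and $W_k=V_k\ominus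 V_{k+1}$; let $H_k$ be the subspace $W_k$ obtained for $V=\mathcal H$, and let $P_k$ be the orthogonal projection of $\mathcal H$ onto $H_k$. For every closed subspace $V$ of $\mathcal H$, the following three conditions are equivalent: (a) $V$ is $R_1$-invariant: $R_1V\subseteq V$; (b) $V$ is an $R$-submodule: $RV\subseteq V$; (c) the decomposition $(W_k)_{k\ge 0}$ is $R_1$-inner and has the full projection property, that is, for all $k,m\ge0$, $r\in R_1$, $h\in W_k$ and $g\in V$: if $\operatorname{ord}(rh-g)>m$ then $rh-g\perp W_m$, and if $\operatorname{ord}(rh-g)\ge m$ then $P_m(rh-g)\in P_m(W_m)$. -/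

import Mathlib

open scoped Manifold ContDiff

/-! ### Valuation algebras, valuation Hilbert modules, homogeneous decompositions -/

section Abstract

/-- Analytic valuations on a (unital) complex algebra. A left or right unit is an element with a
one-sided inverse. -/
structure IsAnalyticValuation {R : Type*} [Ring R] [Algebra ℂ R] (ord : R → ℕ∞) : Prop where
  unit : ∀ r s : R, r * s = 1 → ord r = 0 ∧ ord s = 0
  eq_top_iff : ∀ r : R, ord r = ⊤ ↔ r = 0
  mul : ∀ r s : R, ord r + ord s ≤ ord (r * s)
  smul : ∀ (c : ℂ) (r : R), c ≠ 0 → ord (c • r) = ord r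
  add : ∀ r s : R, min (ord r) (ord s) ≤ ord (r + s)

/-- The valuation algebra `(R, ord)` is unital: `R = ℂ 1 + R₁`, where `R₁ = {r | 1 ≤ ord r}`. -/
def IsUnitalValuation {R : Type*} [Ring R] [Algebra ℂ R] (ord : R → ℕ∞) : Prop :=
  ∀ r : R, ∃ (c : ℂ) (s : R), 1 ≤ ord s ∧ r = c • 1 + s

variable {R : Type*} [Ring R] [Algebra ℂ R]
  {H : Type*} [NormedAddCommGroup H] [InnerProductSpace ℂ H] [Module R H]

/-- `H` is a (left) Hilbert module over `R`: a Hilbert space and a left `R`-module, with scalar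
multiplications compatible, on which every `r : R` acts continuously. -/
structure IsHilbertModule (R : Type*) [Ring R] [Algebra ℂ R]
    (H : Type*) [NormedAddCommGroup H] [InnerProductSpace ℂ H] [Module R H] : Prop where
  complete : CompleteSpace H
  scalarTower : IsScalarTower ℂ R H
  continuous_smul : ∀ r : R, Continuous fun h : H => r • h

/-- Hilbert module valuations. -/
structure IsHilbertModuleValuation (ordR : R → ℕ∞) (ordH : H → ℕ∞) : Prop where
  eq_top_iff : ∀ h : H, ordH h = ⊤ ↔ h = 0
  smul : ∀ (r : R) (h : H), ordR r + ordH h ≤ ordH (r • h)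
  complex_smul : ∀ (c : ℂ) (h : H), c ≠ 0 → ordH (c • h) = ordH h
  add : ∀ g h : H, min (ordH g) (ordH h) ≤ ordH (g + h)
  upperSemicontinuous : UpperSemicontinuous ordH

/-- `V_k = {h ∈ V | ord h ≥ k}`, the `k`-th term of the valuation subspace series of `V`. -/
def valuationSubspace (ordH : H → ℕ∞) (V : Submodule ℂ H) (k : ℕ) : Set H :=
  {h | h ∈ V ∧ (k : ℕ∞) ≤ ordH h}

/-- `W_k = V_k ⊖ V_{k+1}`, the `k`-th valuation homogeneous component of `V`. -/
def homogeneousComponent (ordH : H → ℕ∞) (V : Submodule ℂ H) (k : ℕ) : Set H :=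
  {h | h ∈ valuationSubspace ordH V k ∧
    ∀ g ∈ valuationSubspace ordH V (k + 1), inner ℂ g h = 0}

/-- `p` is the orthogonal projection of `x` on the subspace with underlying set `S`. -/
def IsOrthProjection (S : Set H) (x p : H) : Prop :=
  p ∈ S ∧ ∀ s ∈ S, inner ℂ s (x - p) = 0

/-- The subspace `V` is `R₁`-invariant, `R₁ = {r | 1 ≤ ord r}`. -/
def IsROneInvariant (ordR : R → ℕ∞) (V : Submodule ℂ H) : Prop :=
  ∀ r : R, 1 ≤ ordR r → ∀ h ∈ V, r • h ∈ V

/-- The subspace `V` is an `R`-submodule. -/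
def IsRInvariant (R : Type*) [Ring R] [Module R H] (V : Submodule ℂ H) : Prop :=
  ∀ r : R, ∀ h ∈ V, r • h ∈ V

/-- The valuation homogeneous decomposition of `V` is `R₁`-inner: if `r ∈ R₁`, `h ∈ W_k`, `g ∈ V`
and `ord (r h - g) > m`, then `r h - g ⟂ W_m`. -/
def IsROneInner (ordR : R → ℕ∞) (ordH : H → ℕ∞) (V : Submodule ℂ H) : Prop :=
  ∀ k m : ℕ, ∀ r : R, 1 ≤ ordR r → ∀ h ∈ homogeneousComponent ordH V k, ∀ g ∈ V,
    (m : ℕ∞) < ordH (r • h - g) →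
      ∀ w ∈ homogeneousComponent ordH V m, inner ℂ w (r • h - g) = 0

/-- The valuation homogeneous decomposition of `V` has the full projection property: if `r ∈ R₁`,
`h ∈ W_k`, `g ∈ V` and `ord (r h - g) ≥ m`, then `P_m (r h - g) ∈ P_m (W_m)`, where `P_m` is the
orthogonal projection of `H` on the `m`-th homogeneous component of the whole space `H`. -/
def HasFullProjection (ordR : R → ℕ∞) (ordH : H → ℕ∞) (V : Submodule ℂ H) : Prop :=
  ∀ k m : ℕ, ∀ r : R, 1 ≤ ordR r → ∀ h ∈ homogeneousComponent ordH V k, ∀ g ∈ V,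
    (m : ℕ∞) ≤ ordH (r • h - g) →
      ∃ w ∈ homogeneousComponent ordH V m, ∃ p : H,
        IsOrthProjection (homogeneousComponent ordH ⊤ m) (r • h - g) p ∧
        IsOrthProjection (homogeneousComponent ordH ⊤ m) w p

end Abstract

/-! ### Analytic algebras and analytic Hilbert modules on a Riemann surface -/

section Surface

variable {Ω : Type*} [TopologicalSpace Ω] [ChartedSpace ℂ Ω]

/-- The order of the zero of `f` at `a`: the least degree of a nonzero term in the power series of
`f` in a local coordinate at `a`, and `⊤` if there is none. -/
noncomputable def zeroOrder (a : Ω) (f : Ω → ℂ) : ℕ∞ :=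
  analyticOrderAt (f ∘ (chartAt ℂ a).symm) (chartAt ℂ a a)

/-- An algebra of functions on `Ω` is an analytic algebra (with basepoint `a`) if it consists of
analytic functions and the order of the zero at `a` is an analytic valuation on it. -/
structure IsAnalyticAlgebra (a : Ω) (R : Subalgebra ℂ (Ω → ℂ)) : Prop where
  analytic : ∀ r : R, MDifferentiable 𝓘(ℂ) 𝓘(ℂ) (r : Ω → ℂ)
  valuation : IsAnalyticValuation fun r : R => zeroOrder a (r : Ω → ℂ)

/-- A space `H` of functions on `Ω` is presented by its `R`-linear inclusion `ev` in `Ω → ℂ`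
(so `R` acts on it by pointwise multiplication). It is an analytic Hilbert module over the analytic
algebra `R` if it is a Hilbert module over `R` consisting of analytic functions, the order of the
zero at `a` is a Hilbert module valuation on it, and norm convergence implies uniform convergence
on the compact subsets of some open neighborhood of `a`. -/
structure IsAnalyticHilbertModule (a : Ω) (R : Subalgebra ℂ (Ω → ℂ))
    {H : Type*} [NormedAddCommGroup H] [InnerProductSpace ℂ H] [Module R H]
    (ev : H →ₗ[R] (Ω → ℂ)) : Prop where
  analyticAlgebra : IsAnalyticAlgebra a R
  injective : Function.Injective ev
  analytic : ∀ h : H, MDifferentiable 𝓘(ℂ) 𝓘(ℂ) (ev h)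
  hilbertModule : IsHilbertModule R H
  valuation : IsHilbertModuleValuation (fun r : R => zeroOrder a (r : Ω → ℂ))
    (fun h : H => zeroOrder a (ev h))
  uniform_on_compacts : ∃ U : Set Ω, IsOpen U ∧ a ∈ U ∧
    ∀ (f : ℕ → H) (h : H), Filter.Tendsto f Filter.atTop (nhds h) →
      ∀ K ⊆ U, IsCompact K →
        TendstoUniformlyOn (fun n => ev (f n)) (ev h) Filter.atTop K

/-! ### Harmonic majorants, `H^∞` and `H²` -/

/-- A real function on a Riemann surface is harmonic if it is harmonic in every local coordinate. -/
def IsHarmonic (u : Ω → ℝ) : Prop :=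
  ∀ e ∈ atlas ℂ Ω, InnerProductSpace.HarmonicOnNhd (u ∘ e.symm) e.target

/-- The set of harmonic majorants of `s`. -/
def harmonicMajorants (s : Ω → ℝ) : Set (Ω → ℝ) :=
  {u | IsHarmonic u ∧ s ≤ u}

theorem IsHarmonic.add {u v : Ω → ℝ} (hu : IsHarmonic u) (hv : IsHarmonic v) :
    IsHarmonic (u + v) := fun e he => (hu e he).add (hv e he)

theorem IsHarmonic.const_smul {u : Ω → ℝ} (c : ℝ) (hu : IsHarmonic u) :
    IsHarmonic (c • u) := fun e he => (hu e he).const_smul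

theorem isHarmonic_zero : IsHarmonic (0 : Ω → ℝ) :=
  fun _ _ _ _ => InnerProductSpace.harmonicAt_const (0 : ℝ)

variable (Ω)

/-- `H^∞(Ω)`: the algebra of bounded analytic functions on `Ω`. -/
def HInf : Subalgebra ℂ (Ω → ℂ) where
  carrier := {f | MDifferentiable 𝓘(ℂ) 𝓘(ℂ) f ∧ ∃ C : ℝ, ∀ x, ‖f x‖ ≤ C}
  mul_mem' := by
    rintro f g ⟨hf, C, hC⟩ ⟨hg, D, hD⟩
    refine ⟨hf.mul hg, C * D, fun x => ?_⟩
    rw [Pi.mul_apply, norm_mul]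
    exact mul_le_mul (hC x) (hD x) (norm_nonneg _) ((norm_nonneg _).trans (hC x))
  add_mem' := by
    rintro f g ⟨hf, C, hC⟩ ⟨hg, D, hD⟩
    exact ⟨hf.add hg, C + D, fun x => (norm_add_le _ _).trans (add_le_add (hC x) (hD x))⟩
  algebraMap_mem' c := ⟨mdifferentiable_const (c := c), ‖c‖, fun _ => le_rfl⟩

/-- `H²(Ω)` as a space of functions, closed under multiplication by `H^∞(Ω)`: the analytic `h` such
that `|h|²` has a harmonic majorant. -/
def hardyTwo : Submodule (HInf Ω) (Ω → ℂ) where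
  carrier := {h | MDifferentiable 𝓘(ℂ) 𝓘(ℂ) h ∧ (harmonicMajorants fun x => ‖h x‖ ^ 2).Nonempty}
  zero_mem' := ⟨mdifferentiable_const (c := (0 : ℂ)), 0, isHarmonic_zero, fun x => by simp⟩
  add_mem' := by
    rintro f g ⟨hf, u, hu, hfu⟩ ⟨hg, v, hv, hgv⟩
    refine ⟨hf.add hg, (2 : ℝ) • (u + v), (hu.add hv).const_smul 2, fun x => ?_⟩
    have h1 : ‖f x‖ ^ 2 ≤ u x := hfu x
    have h2 : ‖g x‖ ^ 2 ≤ v x := hgv x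
    have h3 : ‖f x + g x‖ ^ 2 ≤ (‖f x‖ + ‖g x‖) ^ 2 :=
      pow_le_pow_left₀ (norm_nonneg _) (norm_add_le _ _) 2
    show ‖f x + g x‖ ^ 2 ≤ 2 * (u x + v x)
    nlinarith [sq_nonneg (‖f x‖ - ‖g x‖)]
  smul_mem' := by
    rintro ⟨r, hr, C, hC⟩ f ⟨hf, u, hu, hfu⟩
    refine ⟨hr.mul hf, (C ^ 2) • u, hu.const_smul _, fun x => ?_⟩
    have h1 : ‖f x‖ ^ 2 ≤ u x := hfu x
    have h2 : ‖r x‖ ^ 2 ≤ C ^ 2 := pow_le_pow_left₀ (norm_nonneg _) (hC x) 2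
    show ‖r x * f x‖ ^ 2 ≤ C ^ 2 * u x
    rw [norm_mul, mul_pow]
    exact mul_le_mul h2 h1 (sq_nonneg _) (sq_nonneg _)

/-- `H²(Ω)` as a type, with its pointwise algebraic structure and no topology. -/
def HardyTwo : Type _ := hardyTwo Ω

instance : AddCommGroup (HardyTwo Ω) := inferInstanceAs (AddCommGroup (hardyTwo Ω))

instance : Module ℂ (HardyTwo Ω) := inferInstanceAs (Module ℂ (hardyTwo Ω))

instance : Module (HInf Ω) (HardyTwo Ω) := inferInstanceAs (Module (HInf Ω) (hardyTwo Ω))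

/-- The inclusion of `H²(Ω)` in the space of all functions on `Ω`. -/
def HardyTwo.eval : HardyTwo Ω →ₗ[HInf Ω] (Ω → ℂ) := (hardyTwo Ω).subtype

end Surface

/-!
The analytic content is the potential theory of `Ω`, developed here from the Poisson integral
formula and without any countability assumption on `Ω`; the description of the invariant subspaces
is then a formal consequence of the valuation.

*Least harmonic majorants.* Let `s` be continuous and subharmonic with a harmonic majorant. The
Perron family of `s` consists of the continuous subharmonic functions lying below every continuous
superharmonic majorant of `s`. It is closed under maxima and under solving the Dirichlet problem in
a disc of a chart (`IsChartDisc.poissonModification_mem_perronFamily`), and bounded pointwise limits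
of harmonic functions are harmonic (`harmonicOnNhd_of_tendsto`), so its upper envelope is harmonic
(`isHarmonic_leastHarmonicMajorant`). By construction the envelope lies below all *superharmonic*
majorants of `s`, and not only below the harmonic ones. This is what makes `s ↦ u_s` additive
(`leastHarmonicMajorant_add`), where `u_s` denotes the least harmonic majorant: if `U` is a harmonic
majorant of `s + t`, then `U - t` is a superharmonic majorant of `s`.

*The inner product.* Hence `s ↦ u_s(a)` extends to a linear functional on differences of majorized
subharmonic functions (`majorantFunctional`). For `g, h` in `H²(Ω)` the real and imaginary parts of
`conj g * h` are such differences, by polarization, and the inner product is the value of the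
functional there. It is definite because a nonnegative harmonic function vanishing at `a` is zero.

*Completeness and convergence.* Harnack's inequality (`exists_nhds_harnack`) bounds point
evaluations locally uniformly, which gives uniform convergence on all compact sets and, with the
convergence of derivatives, the upper semicontinuity of the order at `a`. If `∑ ‖g k‖` converges,
then the Cauchy–Schwarz inequality gives
`|∑ g k|² ≤ (∑ ‖g k‖) (∑ u k / ‖g k‖)`, with `u k` the least harmonic majorant of `|g k|²`. The
right-hand side is harmonic by Harnack's principle and equals `(∑ ‖g k‖)²` at `a`
(`HardyTwo.exists_sum_of_summable`).

*Invariant subspaces.* Since the order is upper semicontinuous, the `V_k` are closed, so that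
`V_k = W_k ⊕ V_{k+1}`, and `V` is the closed span of the `W_k` because only `0` has infinite order.
If `V` is invariant, then `f = r h - g` lies in `V`, and both properties are read off from this
decomposition. Conversely, for `h ∈ W_k` let `f` be the component of `r h` orthogonal to `V`, and
suppose that it has finite order `m`. The full projection property yields `w ∈ W_m` with
`ord (f - w) > m`; since the decomposition is `R₁`-inner, `f - w ⟂ w`, and so `w = 0`, which
contradicts `ord f = m`.
-/

/-! ### Poisson integrals and the local sub-mean value property in the plane -/

section PlanePotentialTheory

open InnerProductSpace Metric Set Filter Topology Real

/-- Harmonicity is invariant under analytic changes of coordinate: locally a harmonic function is the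
real part of an analytic one. -/
theorem InnerProductSpace.HarmonicAt.comp_analyticAt {f : ℂ → ℝ} {φ : ℂ → ℂ} {z : ℂ}
    (hf : HarmonicAt f (φ z)) (hφ : AnalyticAt ℂ φ z) : HarmonicAt (f ∘ φ) z := by
  obtain ⟨ε, hε, hball⟩ := Metric.isOpen_iff.1 (isOpen_setOfPred_harmonicAt f) _ hf
  obtain ⟨F, hF, hFf⟩ := HarmonicOnNhd.exists_analyticOnNhd_ball_re_eq (f := f) (z := φ z) (R := ε)
    fun x hx => hball hx
  have h1 : HarmonicAt (fun w => ((F ∘ φ) w).re) z :=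
    ((hF _ (mem_ball_self hε)).comp hφ).harmonicAt_re
  refine (harmonicAt_congr_nhds ?_).1 h1
  filter_upwards [hφ.continuousAt.preimage_mem_nhds (ball_mem_nhds _ hε)] with w hw
  exact hFf hw

/-- The Poisson integral, at the point `w` of the disc of centre `c` and radius `R`, of a function
`φ` on its boundary circle. -/
noncomputable def poissonIntegral (c : ℂ) (R : ℝ) (φ : ℂ → ℝ) (w : ℂ) : ℝ :=
  circleAverage (poissonKernel c w • φ) c R

theorem poissonKernel_continuousOn_sphere {c w : ℂ} {R : ℝ} (hw : w ∈ ball c R) :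
    ContinuousOn (poissonKernel c w) (sphere c |R|) := by
  rw [poissonKernel_eq_re_herglotzRieszKernel]
  exact Complex.continuous_re.comp_continuousOn (continuousOn_herglotzRieszKernel_sphere hw)

theorem poissonKernel_lower_bound {c w z : ℂ} {R : ℝ} (hw : w ∈ ball c R) (hz : z ∈ sphere c R) :
    (R - ‖w - c‖) / (R + ‖w - c‖) ≤ poissonKernel c w z := by
  rw [poissonKernel_eq_re_herglotzRieszKernel]
  exact le_re_herglotzRieszKernel hz hw

theorem poissonKernel_upper_bound {c w z : ℂ} {R : ℝ} (hw : w ∈ ball c R) (hz : z ∈ sphere c R) :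
    poissonKernel c w z ≤ (R + ‖w - c‖) / (R - ‖w - c‖) := by
  rw [poissonKernel_eq_re_herglotzRieszKernel]
  exact re_herglotzRieszKernel_le hz hw

theorem poissonKernel_nonneg_of_mem_sphere {c w z : ℂ} {R : ℝ} (hw : w ∈ ball c R)
    (hz : z ∈ sphere c R) : 0 ≤ poissonKernel c w z := by
  refine le_trans ?_ (poissonKernel_lower_bound hw hz)
  have := mem_ball_iff_norm.1 hw
  have := norm_nonneg (w - c)
  exact div_nonneg (by linarith) (by linarith)

theorem circleIntegrable_poissonKernel_smul {c w : ℂ} {R : ℝ} {φ : ℂ → ℝ}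
    (hφ : CircleIntegrable φ c R) (hw : w ∈ ball c R) :
    CircleIntegrable (poissonKernel c w • φ) c R :=
  hφ.continuousOn_smul (poissonKernel_continuousOn_sphere hw)

/-- The Poisson integral is the real part of the Herglotz–Riesz integral, which is analytic. -/
theorem harmonicOnNhd_poissonIntegral {c : ℂ} {R : ℝ} {φ : ℂ → ℝ} (hφ : CircleIntegrable φ c R) :
    HarmonicOnNhd (poissonIntegral c R φ) (ball c R) := by
  have hφ0 : CircleIntegrable (fun z => φ (z + c)) 0 R := by
    have : (fun θ => φ (circleMap 0 R θ + c)) = fun θ => φ (circleMap c R θ) := by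
      funext θ; simp [circleMap, add_comm]
    simpa [CircleIntegrable, this] using hφ
  have hφC : CircleIntegrable (fun z => ((φ (z + c) : ℝ) : ℂ)) 0 R := by
    simp only [CircleIntegrable, intervalIntegrable_iff] at hφ0 ⊢
    exact Complex.ofRealCLM.integrable_comp hφ0
  intro w hw
  have hw0 : w - c ∈ ball (0 : ℂ) R := by rw [mem_ball_zero_iff]; exact mem_ball_iff_norm.1 hw
  have key := (analyticOnNhd_circleAverage_herglotzRieszKernel_smul hφC (w - c) hw0).harmonicAt_re
  have key2 := InnerProductSpace.HarmonicAt.comp_analyticAt (φ := fun z => z - c) (z := w) key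
    (by fun_prop)
  refine (harmonicAt_congr_nhds ?_).1 key2
  filter_upwards [isOpen_ball.mem_nhds hw] with x hx
  have hx0 : x - c ∈ ball (0 : ℂ) R := by rw [mem_ball_zero_iff]; exact mem_ball_iff_norm.1 hx
  have := re_circleAverage_herglotzRieszKernel_smul hφ0 hx0
  simp only [Function.comp_apply]
  rw [this, poissonIntegral, poissonKernel_eq_re_herglotzRieszKernel,
    ← circleAverage_map_add_const (c := c)]
  congr 1
  funext z
  simp [herglotzRieszKernel_add_const]

theorem poissonIntegral_eq_of_harmonicContOnCl {c w : ℂ} {R : ℝ} {f : ℂ → ℝ}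
    (hf : HarmonicContOnCl f (ball c R)) (hw : w ∈ ball c R) : poissonIntegral c R f w = f w :=
  hf.circleAverage_poissonKernel_smul hw

theorem circleAverage_poissonKernel {c w : ℂ} {R : ℝ} (hw : w ∈ ball c R) :
    circleAverage (poissonKernel c w) c R = 1 := by
  have := (harmonicContOnCl_const (c := (1 : ℝ)) (s := ball c R)).circleAverage_poissonKernel_smul hw
  rw [← this]
  congr 1
  funext z; simp

/-- A function bounded by `M` on a circle whose mean is at least `M` is the constant `M`. -/
theorem eqOn_sphere_of_le_circleAverage {c : ℂ} {r M : ℝ} {f : ℂ → ℝ}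
    (hf : ContinuousOn f (sphere c |r|)) (hle : ∀ z ∈ sphere c |r|, f z ≤ M)
    (hM : M ≤ circleAverage f c r) : ∀ z ∈ sphere c |r|, f z = M := by
  intro z hz
  by_contra hne
  have hlt : f z < M := lt_of_le_of_ne (hle z hz) hne
  obtain ⟨θ, hθ, rfl⟩ : ∃ θ ∈ Ioc 0 (2 * π), circleMap c r θ = z := by
    rw [← image_circleMap_Ioc] at hz; exact hz
  have hc : Continuous fun θ => f (circleMap c r θ) :=
    hf.comp_continuous (continuous_circleMap _ _) (circleMap_mem_sphere' _ _)
  have h1 : ∫ θ in (0 : ℝ)..2 * π, f (circleMap c r θ) < ∫ _ in (0 : ℝ)..2 * π, M :=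
    intervalIntegral.integral_lt_integral_of_continuousOn_of_le_of_exists_lt two_pi_pos
      hc.continuousOn continuousOn_const (fun θ _ => hle _ (circleMap_mem_sphere' _ _ _))
      ⟨θ, ⟨hθ.1.le, hθ.2⟩, hlt⟩
  have h2 : circleAverage f c r < circleAverage (fun _ => M) c r := by
    simp only [circleAverage, smul_eq_mul]
    exact mul_lt_mul_of_pos_left h1 (inv_pos.2 two_pi_pos)
  rw [circleAverage_const] at h2
  exact absurd hM (not_le.2 h2)

/-- The local sub-mean value property at `z`: the value there is at most the mean over every small
circle around `z`. -/
def SubmeanAt (v : ℂ → ℝ) (z : ℂ) : Prop :=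
  ∀ᶠ r in 𝓝[>] (0 : ℝ), v z ≤ circleAverage v z r

theorem eventually_closedBall_subset_of_mem_nhds {z : ℂ} {s : Set ℂ} (hs : s ∈ 𝓝 z) :
    ∀ᶠ r in 𝓝[>] (0 : ℝ), 0 < r ∧ closedBall z r ⊆ s := by
  obtain ⟨ε, hε, h⟩ := Metric.mem_nhds_iff.1 hs
  filter_upwards [Ioo_mem_nhdsGT hε] with r hr
  exact ⟨hr.1, (closedBall_subset_ball hr.2).trans h⟩

theorem InnerProductSpace.HarmonicAt.eventually_circleAverage_eq {E : Type*}
    [NormedAddCommGroup E] [NormedSpace ℝ E] [CompleteSpace E] {f : ℂ → E} {z : ℂ}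
    (hf : HarmonicAt f z) : ∀ᶠ r in 𝓝[>] (0 : ℝ), circleAverage f z r = f z := by
  filter_upwards [eventually_closedBall_subset_of_mem_nhds hf.eventually] with r hr
  refine InnerProductSpace.HarmonicOnNhd.circleAverage_eq fun x hx => hr.2 ?_
  rwa [abs_of_pos hr.1] at hx

theorem InnerProductSpace.HarmonicAt.submeanAt {f : ℂ → ℝ} {z : ℂ} (hf : HarmonicAt f z) :
    SubmeanAt f z := by
  filter_upwards [hf.eventually_circleAverage_eq] with r hr using hr.ge

theorem eventually_circleIntegrable_of_continuousAt {v : ℂ → ℝ} {z : ℂ}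
    (hv : ∀ᶠ y in 𝓝 z, ContinuousAt v y) : ∀ᶠ r in 𝓝[>] (0 : ℝ), CircleIntegrable v z r := by
  filter_upwards [eventually_closedBall_subset_of_mem_nhds hv] with r hr
  refine ContinuousOn.circleIntegrable' fun y hy => (hr.2 ?_ : ContinuousAt v y).continuousWithinAt
  rw [abs_of_pos hr.1] at hy
  exact sphere_subset_closedBall hy

/-- The sub-mean value property at `z` passes to a larger function with the same value at `z`. -/
theorem SubmeanAt.mono_of_eq {v w : ℂ → ℝ} {z : ℂ} (hv : SubmeanAt v z) (h : v z = w z)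
    (hle : ∀ᶠ y in 𝓝 z, v y ≤ w y) (hvc : ∀ᶠ y in 𝓝 z, ContinuousAt v y)
    (hwc : ∀ᶠ y in 𝓝 z, ContinuousAt w y) : SubmeanAt w z := by
  filter_upwards [hv, eventually_circleIntegrable_of_continuousAt hvc,
    eventually_circleIntegrable_of_continuousAt hwc,
    eventually_closedBall_subset_of_mem_nhds hle] with r h1 h2 h3 h4
  rw [← h]
  refine h1.trans (circleAverage_mono h2 h3 fun x hx => h4.2 ?_)
  rw [abs_of_pos h4.1] at hx
  exact sphere_subset_closedBall hx

theorem SubmeanAt.add {v w : ℂ → ℝ} {z : ℂ} (hv : SubmeanAt v z) (hw : SubmeanAt w z)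
    (hvc : ∀ᶠ y in 𝓝 z, ContinuousAt v y) (hwc : ∀ᶠ y in 𝓝 z, ContinuousAt w y) :
    SubmeanAt (v + w) z := by
  filter_upwards [hv, hw, eventually_circleIntegrable_of_continuousAt hvc,
    eventually_circleIntegrable_of_continuousAt hwc] with r h1 h2 h3 h4
  rw [circleAverage_add h3 h4]
  exact add_le_add h1 h2

theorem SubmeanAt.smul {v : ℂ → ℝ} {z : ℂ} {c : ℝ} (hc : 0 ≤ c) (hv : SubmeanAt v z) :
    SubmeanAt (c • v) z := by
  filter_upwards [hv] with r h1
  rw [circleAverage_smul]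
  exact mul_le_mul_of_nonneg_left h1 hc

/-- This is the mean value property of the analytic function `h ^ 2`. -/
theorem submeanAt_norm_sq {h : ℂ → ℂ} {z : ℂ} (hh : AnalyticAt ℂ h z) :
    SubmeanAt (fun w => ‖h w‖ ^ 2) z := by
  have h2 : AnalyticAt ℂ (fun w => h w ^ 2) z := hh.pow 2
  filter_upwards [InnerProductSpace.HarmonicAt.eventually_circleAverage_eq h2.harmonicAt] with r hr
  rw [← norm_pow, ← hr, circleAverage, circleAverage, norm_smul, smul_eq_mul, Real.norm_eq_abs,
    abs_of_pos (inv_pos.2 two_pi_pos)]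
  refine mul_le_mul_of_nonneg_left ?_ (inv_pos.2 two_pi_pos).le
  refine (intervalIntegral.norm_integral_le_integral_norm two_pi_pos.le).trans (le_of_eq ?_)
  exact intervalIntegral.integral_congr fun θ _ => norm_pow _ _

/-- **Maximum principle** on a disc, for functions with the local sub-mean value property. -/
theorem nonpos_of_submeanAt {c : ℂ} {R : ℝ} {f : ℂ → ℝ} (hf : ContinuousOn f (closedBall c R))
    (hsub : ∀ z ∈ ball c R, SubmeanAt f z) (hbd : ∀ z ∈ sphere c R, f z ≤ 0) :
    ∀ z ∈ closedBall c R, f z ≤ 0 := by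
  intro z hz
  obtain ⟨z₁, hz₁, hmax⟩ := (isCompact_closedBall c R).exists_isMaxOn ⟨z, hz⟩ hf
  refine (hmax hz).trans ?_
  by_contra! hM
  set K := closedBall c R ∩ f ⁻¹' {f z₁} with hK
  -- a positive maximum would be attained on a nonempty compact set `K` that is also open in `ℂ`
  have hKb : K ⊆ ball c R := by
    rintro y ⟨hy1, hy2⟩
    rcases (mem_closedBall.1 hy1).lt_or_eq with h | h
    · exact h
    · have := hbd y h
      rw [mem_preimage, mem_singleton_iff] at hy2
      linarith
  have hcl : IsClosed K := hf.preimage_isClosed_of_isClosed isClosed_closedBall isClosed_singleton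
  have hop : IsOpen K := by
    rw [isOpen_iff_mem_nhds]
    intro y hy
    have hyb := hKb hy
    have hev := (eventually_closedBall_subset_of_mem_nhds (isOpen_ball.mem_nhds hyb)).and
      (hsub y hyb)
    obtain ⟨ε, hε, hεs⟩ := mem_nhdsGT_iff_exists_Ioo_subset.1 hev
    refine mem_of_superset (ball_mem_nhds y hε) fun x hx => ?_
    rcases eq_or_ne x y with rfl | hxy
    · exact hy
    have hr := hεs ⟨dist_pos.2 hxy, hx⟩
    have habs : |dist x y| = dist x y := abs_of_nonneg dist_nonneg
    have hss : sphere y |dist x y| ⊆ closedBall c R := by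
      rw [habs]; exact (sphere_subset_closedBall.trans hr.1.2).trans ball_subset_closedBall
    have hxs : x ∈ sphere y |dist x y| := by rw [habs]; exact rfl
    refine ⟨hss hxs, eqOn_sphere_of_le_circleAverage (hf.mono hss) (fun w hw => hmax (hss hw)) ?_ x hxs⟩
    rw [← hy.2]; exact hr.2
  have huniv : K = univ := IsClopen.eq_univ ⟨hcl, hop⟩ ⟨z₁, hz₁, rfl⟩
  have : c + ((|R| + 1 : ℝ) : ℂ) ∈ K := huniv ▸ mem_univ _
  have h3 := mem_ball_iff_norm.1 (hKb this)
  rw [add_sub_cancel_left, Complex.norm_real, Real.norm_eq_abs, abs_of_pos (by positivity)] at h3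
  linarith [le_abs_self R]

theorem le_of_submeanAt_of_harmonicContOnCl {c : ℂ} {R : ℝ} {v g : ℂ → ℝ}
    (hv : ContinuousOn v (closedBall c R)) (hsub : ∀ z ∈ ball c R, SubmeanAt v z)
    (hg : HarmonicContOnCl g (ball c R)) (hbd : ∀ z ∈ sphere c R, v z ≤ g z) :
    ∀ z ∈ closedBall c R, v z ≤ g z := by
  have hmem : ∀ z ∈ ball c R, ∀ᶠ y in 𝓝 z, closedBall c R ∈ 𝓝 y := fun z hz => by
    filter_upwards [isOpen_ball.mem_nhds hz] with y hy
    exact mem_of_superset (isOpen_ball.mem_nhds hy) ball_subset_closedBall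
  have hgn : ∀ z ∈ ball c R, HarmonicAt (-g) z := fun z hz => (hg.1 z hz).neg
  have := nonpos_of_submeanAt (f := v + -g) (hv.add hg.continuousOn_ball.neg) (fun z hz =>
    (hsub z hz).add (hgn z hz).submeanAt
      ((hmem z hz).mono fun y hy => hv.continuousAt hy)
      ((hmem z hz).mono fun y hy => (hg.continuousOn_ball.neg).continuousAt hy))
    (fun z hz => by simpa using hbd z hz)
  intro z hz
  simpa using this z hz

/-- The Poisson integral of a continuous function attains its boundary values. Near the boundary
point `ζ` the kernel has mean one, and it is uniformly small on the part of the circle away from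
`ζ`. -/
theorem tendsto_poissonIntegral {c : ℂ} {R : ℝ} {φ : ℂ → ℝ} (hφ : ContinuousOn φ (sphere c R))
    {ζ : ℂ} (hζ : ζ ∈ sphere c R) :
    Tendsto (poissonIntegral c R φ) (𝓝[ball c R] ζ) (𝓝 (φ ζ)) := by
  rcases le_or_gt R 0 with hR | hR
  · simp [ball_eq_empty.2 hR]
  rw [Metric.tendsto_nhds]
  intro ε hε
  obtain ⟨δ, hδ, hφδ⟩ := Metric.continuousOn_iff.1 hφ ζ hζ (ε / 2) (by positivity)
  obtain ⟨M, hM⟩ := (isCompact_sphere c R).exists_bound_of_continuousOn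
    (hφ.sub (continuousOn_const (c := φ ζ)))
  have hM0 : 0 ≤ M := (norm_nonneg _).trans (hM ζ hζ)
  have hsmall : ∀ᶠ w in 𝓝[ball c R] ζ, (R ^ 2 - ‖w - c‖ ^ 2) * (4 * M / δ ^ 2) < ε / 2 := by
    have hc : Continuous fun w : ℂ => (R ^ 2 - ‖w - c‖ ^ 2) * (4 * M / δ ^ 2) := by fun_prop
    refine nhdsWithin_le_nhds (hc.continuousAt.eventually_lt continuousAt_const ?_)
    rw [mem_sphere_iff_norm.1 hζ]; simp; positivity
  filter_upwards [hsmall, self_mem_nhdsWithin,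
    nhdsWithin_le_nhds (ball_mem_nhds ζ (half_pos hδ))] with w hw1 hwb hwδ
  have hab : |R| = R := abs_of_pos hR
  have hwn := mem_ball_iff_norm.1 hwb
  have hP : CircleIntegrable (poissonKernel c w) c R :=
    (poissonKernel_continuousOn_sphere hwb).circleIntegrable'
  have hφi : CircleIntegrable φ c R := hφ.circleIntegrable hR.le
  have hdiff : CircleIntegrable (fun z => poissonKernel c w z * (φ z - φ ζ)) c R :=
    circleIntegrable_poissonKernel_smul (hφi.sub (circleIntegrable_const _ _ _)) hwb
  have heq : poissonIntegral c R φ w - φ ζ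
      = circleAverage (fun z => poissonKernel c w z * (φ z - φ ζ)) c R := by
    have h1 : φ ζ = circleAverage (φ ζ • poissonKernel c w) c R := by
      rw [circleAverage_smul, circleAverage_poissonKernel hwb]; simp
    conv_lhs => rw [h1]
    rw [poissonIntegral, ← circleAverage_sub (circleIntegrable_poissonKernel_smul hφi hwb)
      (hP.const_smul)]
    congr 1
    funext z; simp; ring
  rw [Real.dist_eq, heq]
  set N := (R ^ 2 - ‖w - c‖ ^ 2) * (4 * M / δ ^ 2) with hN
  have hRw : 0 ≤ R ^ 2 - ‖w - c‖ ^ 2 := by nlinarith [norm_nonneg (w - c)]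
  calc |circleAverage (fun z => poissonKernel c w z * (φ z - φ ζ)) c R|
      ≤ circleAverage |fun z => poissonKernel c w z * (φ z - φ ζ)| c R :=
        abs_circleAverage_le_circleAverage_abs
    _ ≤ circleAverage ((ε / 2) • poissonKernel c w + fun _ => N) c R := by
        refine circleAverage_mono hdiff.abs ((hP.const_smul).add (circleIntegrable_const _ _ _)) ?_
        intro z hz
        rw [hab] at hz
        have hPz := poissonKernel_nonneg_of_mem_sphere hwb hz
        rw [Pi.abs_apply, abs_mul, abs_of_nonneg hPz, Pi.add_apply, Pi.smul_apply, smul_eq_mul]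
        rcases lt_or_ge (dist z ζ) δ with hzδ | hzδ
        · have h1 : |φ z - φ ζ| < ε / 2 := hφδ z hz hzδ
          have h2 : 0 ≤ N := by positivity
          nlinarith
        · have h1 : |φ z - φ ζ| ≤ M := hM z hz
          have h2 : δ / 2 ≤ ‖z - c - (w - c)‖ := by
            rw [sub_sub_sub_cancel_right, ← dist_eq_norm]
            have := dist_triangle z w ζ
            have := mem_ball.1 hwδ
            linarith
          have h3 : poissonKernel c w z ≤ (R ^ 2 - ‖w - c‖ ^ 2) * (4 / δ ^ 2) := by
            rw [poissonKernel_def, mem_sphere_iff_norm.1 hz, div_eq_mul_inv]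
            refine mul_le_mul_of_nonneg_left ?_ hRw
            rw [inv_le_comm₀ (pow_pos (by linarith) 2) (by positivity)]
            calc (4 / δ ^ 2)⁻¹ = (δ / 2) ^ 2 := by field_simp; norm_num
              _ ≤ _ := by gcongr
          calc poissonKernel c w z * |φ z - φ ζ|
              ≤ ((R ^ 2 - ‖w - c‖ ^ 2) * (4 / δ ^ 2)) * M := by gcongr
            _ = N := by rw [hN]; ring
            _ ≤ _ := le_add_of_nonneg_left (by positivity)
    _ = ε / 2 + N := by
        rw [circleAverage_add hP.const_smul (circleIntegrable_const _ _ _), circleAverage_smul, circleAverage_poissonKernel hwb, circleAverage_const]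
        simp
    _ < ε := by linarith

open Classical in
/-- The function which agrees with `φ` off the open disc and with the Poisson integral of `φ` in
it: the solution of the Dirichlet problem on the disc with boundary values `φ`. -/
noncomputable def poissonExtension (c : ℂ) (R : ℝ) (φ : ℂ → ℝ) (w : ℂ) : ℝ :=
  if w ∈ ball c R then poissonIntegral c R φ w else φ w

theorem poissonExtension_of_mem {c w : ℂ} {R : ℝ} {φ : ℂ → ℝ} (hw : w ∈ ball c R) :
    poissonExtension c R φ w = poissonIntegral c R φ w := if_pos hw

theorem poissonExtension_of_notMem {c w : ℂ} {R : ℝ} {φ : ℂ → ℝ} (hw : w ∉ ball c R) :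
    poissonExtension c R φ w = φ w := if_neg hw

theorem harmonicContOnCl_poissonExtension {c : ℂ} {R : ℝ} {φ : ℂ → ℝ}
    (hφ : ContinuousOn φ (sphere c R)) : HarmonicContOnCl (poissonExtension c R φ) (ball c R) := by
  rcases le_or_gt R 0 with hR | hR
  · rw [ball_eq_empty.2 hR]
    exact ⟨fun _ h => h.elim, by simp⟩
  have hin : HarmonicOnNhd (poissonExtension c R φ) (ball c R) := fun w hw =>
    (harmonicAt_congr_nhds (by
      filter_upwards [isOpen_ball.mem_nhds hw] with x hx
      exact (poissonExtension_of_mem hx).symm)).1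
      (harmonicOnNhd_poissonIntegral (hφ.circleIntegrable hR.le) w hw)
  refine HarmonicContOnCl.mk_ball hin fun w hw => ?_
  rcases (mem_closedBall.1 hw).lt_or_eq with h | h
  · exact (hin w h).1.continuousAt.continuousWithinAt
  · have hws : w ∈ sphere c R := h
    have hnb : w ∉ ball c R := fun h' => (mem_ball.1 h').ne h
    rw [← ball_union_sphere]
    refine ContinuousWithinAt.union ?_ ?_
    · rw [ContinuousWithinAt, poissonExtension_of_notMem hnb]
      refine (tendsto_poissonIntegral hφ hws).congr' ?_
      filter_upwards [self_mem_nhdsWithin] with x hx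
      exact (poissonExtension_of_mem hx).symm
    · refine (hφ w hws).congr (fun y hy => poissonExtension_of_notMem fun h' => ?_)
        (poissonExtension_of_notMem hnb)
      exact (mem_ball.1 h').ne hy

/-- A pointwise limit of uniformly bounded harmonic functions is harmonic: it is represented by its
own Poisson integral, by dominated convergence. -/
theorem harmonicOnNhd_of_tendsto {c : ℂ} {R C : ℝ} {V : ℕ → ℂ → ℝ} {W : ℂ → ℝ}
    (hV : ∀ n, HarmonicContOnCl (V n) (ball c R))
    (hC : ∀ n, ∀ z ∈ sphere c R, |V n z| ≤ C)
    (hlim : ∀ z ∈ closedBall c R, Tendsto (fun n => V n z) atTop (𝓝 (W z))) :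
    HarmonicOnNhd W (ball c R) := by
  rcases le_or_gt R 0 with hR | hR
  · rw [ball_eq_empty.2 hR]; exact fun _ h => h.elim
  have hmem : ∀ θ, circleMap c R θ ∈ sphere c R := fun θ => circleMap_mem_sphere c hR.le θ
  have hVc : ∀ n, Continuous fun θ => V n (circleMap c R θ) := fun n =>
    ((hV n).continuousOn_ball.mono sphere_subset_closedBall).comp_continuous
      (continuous_circleMap _ _) hmem
  have hWm : Measurable fun θ => W (circleMap c R θ) :=
    measurable_of_tendsto_metrizable (fun n => (hVc n).measurable)
      (tendsto_pi_nhds.2 fun θ => hlim _ (sphere_subset_closedBall (hmem θ)))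
  have hWC : ∀ z ∈ sphere c R, |W z| ≤ C := fun z hz =>
    le_of_tendsto ((hlim z (sphere_subset_closedBall hz)).abs) (Eventually.of_forall fun n => hC n z hz)
  have hWi : CircleIntegrable W c R := by
    refine (intervalIntegrable_const (c := C)).mono_fun hWm.aestronglyMeasurable ?_
    refine Eventually.of_forall fun θ => ?_
    rw [Real.norm_eq_abs]
    exact (hWC _ (hmem θ)).trans (le_abs_self C)
  intro w hw
  refine (harmonicAt_congr_nhds ?_).1 (harmonicOnNhd_poissonIntegral hWi w hw)
  filter_upwards [isOpen_ball.mem_nhds hw] with x hx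
  have hPc : Continuous fun θ => poissonKernel c x (circleMap c R θ) :=
    (poissonKernel_continuousOn_sphere hx).comp_continuous
      (continuous_circleMap _ _) (circleMap_mem_sphere' _ _)
  have h1 : Tendsto (fun n => poissonIntegral c R (V n) x) atTop (𝓝 (poissonIntegral c R W x)) := by
    refine Tendsto.const_smul ?_ _
    refine intervalIntegral.tendsto_integral_filter_of_dominated_convergence
      (fun θ => |poissonKernel c x (circleMap c R θ)| * C)
      (Eventually.of_forall fun n => (hPc.mul (hVc n)).aestronglyMeasurable)
      (Eventually.of_forall fun n => Eventually.of_forall fun θ _ => ?_)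
      ((hPc.abs.mul continuous_const).intervalIntegrable _ _)
      (Eventually.of_forall fun θ _ =>
        (hlim _ (sphere_subset_closedBall (hmem θ))).const_mul _)
    simp only [Pi.smul_apply', smul_eq_mul, norm_mul, Real.norm_eq_abs]
    exact mul_le_mul_of_nonneg_left (hC n _ (hmem θ)) (abs_nonneg _)
  refine tendsto_nhds_unique h1 ((hlim x (ball_subset_closedBall hx)).congr fun n => ?_)
  exact (poissonIntegral_eq_of_harmonicContOnCl (hV n) hx).symm

/-- **Harnack's inequality** on a disc. -/
theorem harnack_of_nonneg {c w : ℂ} {R : ℝ} {u : ℂ → ℝ} (hu : HarmonicContOnCl u (ball c R))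
    (hnn : ∀ z ∈ closedBall c R, 0 ≤ u z) (hw : w ∈ ball c (R / 2)) :
    u w ≤ 3 * u c ∧ u c ≤ 3 * u w := by
  have hR : 0 < R := by have := pos_of_mem_ball hw; linarith
  have hwn := mem_ball_iff_norm.1 hw
  have hw0 := norm_nonneg (w - c)
  have hwR : w ∈ ball c R := ball_subset_ball (by linarith) hw
  have hab : |R| = R := abs_of_pos hR
  have hui : CircleIntegrable u c R :=
    (hu.continuousOn_ball.mono sphere_subset_closedBall).circleIntegrable hR.le
  have hc : circleAverage u c R = u c := InnerProductSpace.HarmonicContOnCl.circleAverage_eq (by rwa [hab])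
  have hP := poissonIntegral_eq_of_harmonicContOnCl hu hwR
  have hPi := circleIntegrable_poissonKernel_smul hui hwR
  constructor
  · rw [← hP, ← hc, poissonIntegral, ← smul_eq_mul, ← circleAverage_smul]
    refine circleAverage_mono hPi hui.const_smul fun z hz => ?_
    rw [hab] at hz
    refine mul_le_mul_of_nonneg_right ((poissonKernel_upper_bound hwR hz).trans ?_)
      (hnn z (sphere_subset_closedBall hz))
    rw [div_le_iff₀ (by linarith)]; linarith
  · rw [← hP, ← hc, poissonIntegral, ← smul_eq_mul, ← circleAverage_smul]
    refine circleAverage_mono hui hPi.const_smul fun z hz => ?_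
    rw [hab] at hz
    have h1 : (1 : ℝ) / 3 ≤ poissonKernel c w z := by
      refine le_trans ?_ (poissonKernel_lower_bound hwR hz)
      rw [div_le_div_iff₀ (by norm_num) (by linarith)]; linarith
    have h2 := hnn z (sphere_subset_closedBall hz)
    simp only [Pi.smul_apply, smul_eq_mul]
    change u z ≤ 3 * (poissonKernel c w z * u z)
    nlinarith

/-- A nonnegative harmonic function on a disc vanishing at the centre vanishes. -/
theorem eq_zero_of_nonneg_of_center_eq_zero {c : ℂ} {R : ℝ} {u : ℂ → ℝ}
    (hu : HarmonicOnNhd u (ball c R)) (hnn : ∀ z ∈ ball c R, 0 ≤ u z) (h0 : u c = 0) :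
    ∀ z ∈ ball c R, u z = 0 := by
  intro z hz
  have hsub : closedBall c |dist z c| ⊆ ball c R := by
    rw [abs_of_nonneg dist_nonneg]; exact closedBall_subset_ball hz
  have hav := InnerProductSpace.HarmonicOnNhd.circleAverage_eq (hu.mono hsub)
  have h1 := eqOn_sphere_of_le_circleAverage (f := -u) (c := c) (r := dist z c) (M := 0)
    ((hu.mono hsub).continuousOn.neg.mono sphere_subset_closedBall)
    (fun y hy => by simpa using hnn y (hsub (sphere_subset_closedBall hy)))
    (by rw [← neg_one_smul ℝ u, circleAverage_smul, hav, h0]; simp)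
    z (by rw [abs_of_nonneg dist_nonneg]; exact rfl)
  simpa using h1

end PlanePotentialTheory

/-! ### Subharmonic functions and least harmonic majorants on a surface -/

section SurfacePotentialTheory

open InnerProductSpace Metric Set Filter Topology

variable {Ω : Type*} [TopologicalSpace Ω]

theorem continuousOn_comp_chart_symm {v : Ω → ℝ} (hv : Continuous v)
    (e : OpenPartialHomeomorph Ω ℂ) : ContinuousOn (v ∘ e.symm) e.target :=
  hv.comp_continuousOn e.continuousOn_symm

theorem eventually_continuousAt_comp_chart_symm {v : Ω → ℝ} (hv : Continuous v)
    {e : OpenPartialHomeomorph Ω ℂ} {z : ℂ} (hz : z ∈ e.target) :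
    ∀ᶠ y in 𝓝 z, ContinuousAt (v ∘ e.symm) y := by
  filter_upwards [e.open_target.mem_nhds hz] with y hy
  exact (continuousOn_comp_chart_symm hv e).continuousAt (e.open_target.mem_nhds hy)

theorem continuousOn_poissonExtension {c : ℂ} {R : ℝ} {φ : ℂ → ℝ} {s : Set ℂ}
    (hs : closedBall c R ⊆ s) (hφ : ContinuousOn φ s) :
    ContinuousOn (poissonExtension c R φ) s := by
  have h1 : ContinuousOn (poissonExtension c R φ) (closedBall c R) :=
    (harmonicContOnCl_poissonExtension
      (hφ.mono (sphere_subset_closedBall.trans hs))).continuousOn_ball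
  have h2 : ContinuousOn (poissonExtension c R φ) (s \ ball c R) :=
    (hφ.mono sdiff_subset).congr fun y hy => poissonExtension_of_notMem hy.2
  have hcov : s = closedBall c R ∪ (s \ ball c R) := by
    ext y
    constructor
    · intro hy
      by_cases hyb : y ∈ ball c R
      · exact Or.inl (ball_subset_closedBall hyb)
      · exact Or.inr ⟨hy, hyb⟩
    · rintro (hy | hy)
      exacts [hs hy, hy.1]
  intro y hy
  have h1' : ContinuousWithinAt (poissonExtension c R φ) (closedBall c R) y := by
    by_cases h : y ∈ closedBall c R
    · exact h1 y h
    · exact continuousWithinAt_of_notMem_closure (by rwa [isClosed_closedBall.closure_eq])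
  have h2' : ContinuousWithinAt (poissonExtension c R φ) (s \ ball c R) y := by
    by_cases h : y ∈ ball c R
    · refine continuousWithinAt_of_notMem_closure fun hcl => ?_
      have : s \ ball c R ⊆ (ball c R)ᶜ := fun x hx => hx.2
      exact closure_minimal this isOpen_ball.isClosed_compl hcl h
    · exact h2 y ⟨hy, h⟩
  rw [hcov]
  exact h1'.union h2'

open Classical in
/-- The function which agrees with `v` off a chart disc and solves the Dirichlet problem with
boundary values `v` in it. -/
noncomputable def poissonModification (e : OpenPartialHomeomorph Ω ℂ) (c : ℂ) (R : ℝ) (v : Ω → ℝ)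
    (x : Ω) : ℝ :=
  if x ∈ e.source then poissonExtension c R (v ∘ e.symm) (e x) else v x

theorem poissonModification_of_notMem {e : OpenPartialHomeomorph Ω ℂ} {c : ℂ}
    {R : ℝ} {v : Ω → ℝ} {x : Ω} (h : x ∈ e.source → e x ∉ ball c R) :
    poissonModification e c R v x = v x := by
  by_cases hx : x ∈ e.source
  · rw [poissonModification, if_pos hx, poissonExtension_of_notMem (h hx)]
    simp [e.left_inv hx]
  · rw [poissonModification, if_neg hx]

theorem poissonModification_comp_symm {e : OpenPartialHomeomorph Ω ℂ} {c : ℂ}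
    {R : ℝ} {v : Ω → ℝ} {z : ℂ} (hz : z ∈ e.target) :
    poissonModification e c R v (e.symm z) = poissonExtension c R (v ∘ e.symm) z := by
  rw [poissonModification, if_pos (e.map_target hz), e.right_inv hz]

variable [ChartedSpace ℂ Ω]

theorem analyticAt_chart_transition [IsManifold 𝓘(ℂ) ω Ω] {e e' : OpenPartialHomeomorph Ω ℂ}
    (he : e ∈ atlas ℂ Ω) (he' : e' ∈ atlas ℂ Ω) {x : Ω} (hx : x ∈ e.source) (hx' : x ∈ e'.source) :
    AnalyticAt ℂ (e' ∘ e.symm) (e x) := by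
  have h1 : ContMDiffAt 𝓘(ℂ) 𝓘(ℂ) ω e.symm (e x) :=
    (contMDiffOn_symm_of_mem_maximalAtlas (IsManifold.subset_maximalAtlas he)).contMDiffAt
      (e.open_target.mem_nhds (e.map_source hx))
  have h2 : ContMDiffAt 𝓘(ℂ) 𝓘(ℂ) ω e' (e.symm (e x)) := by
    rw [e.left_inv hx]
    exact (contMDiffOn_of_mem_maximalAtlas (IsManifold.subset_maximalAtlas he')).contMDiffAt
      (e'.open_source.mem_nhds hx')
  exact (contMDiffAt_iff_contDiffAt.1 (h2.comp _ h1)).analyticAt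

theorem harmonicAt_chart_change [IsManifold 𝓘(ℂ) ω Ω] {e e' : OpenPartialHomeomorph Ω ℂ}
    (he : e ∈ atlas ℂ Ω) (he' : e' ∈ atlas ℂ Ω) {x : Ω} (hx : x ∈ e.source) (hx' : x ∈ e'.source)
    {u : Ω → ℝ} (hu : HarmonicAt (u ∘ e.symm) (e x)) : HarmonicAt (u ∘ e'.symm) (e' x) := by
  have h1 := analyticAt_chart_transition he' he hx' hx
  have h2 : HarmonicAt ((u ∘ e.symm) ∘ (e ∘ e'.symm)) (e' x) := by
    refine HarmonicAt.comp_analyticAt ?_ h1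
    simpa [e'.left_inv hx'] using hu
  refine (harmonicAt_congr_nhds ?_).1 h2
  have h3 : e'.symm ⁻¹' e.source ∈ 𝓝 (e' x) :=
    (e'.continuousAt_symm (e'.map_source hx')).preimage_mem_nhds
      (by rw [e'.left_inv hx']; exact e.open_source.mem_nhds hx)
  filter_upwards [h3] with y hy
  simp [e.left_inv hy]

theorem isHarmonic_of_forall_exists_chart [IsManifold 𝓘(ℂ) ω Ω] {u : Ω → ℝ}
    (h : ∀ x, ∃ e ∈ atlas ℂ Ω, x ∈ e.source ∧ HarmonicAt (u ∘ e.symm) (e x)) : IsHarmonic u := by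
  intro e he z hz
  obtain ⟨e', he', hx, hu⟩ := h (e.symm z)
  simpa [e.right_inv hz] using harmonicAt_chart_change he' he hx (e.map_target hz) hu

theorem IsHarmonic.continuous {u : Ω → ℝ} (hu : IsHarmonic u) : Continuous u := by
  rw [continuous_iff_continuousAt]
  intro x
  have hx := mem_chart_source ℂ x
  have h1 : ContinuousAt (u ∘ (chartAt ℂ x).symm) (chartAt ℂ x x) :=
    (hu _ (chart_mem_atlas ℂ x) _ (mem_chart_target ℂ x)).1.continuousAt
  refine (h1.comp ((chartAt ℂ x).continuousAt hx)).congr ?_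
  filter_upwards [(chartAt ℂ x).open_source.mem_nhds hx] with y hy
  simp [(chartAt ℂ x).left_inv hy]

/-- A continuous real function on a surface is subharmonic if it has the local sub-mean value
property at every point of every chart. -/
structure IsSubharmonic (v : Ω → ℝ) : Prop where
  continuous : Continuous v
  submeanAt : ∀ e ∈ atlas ℂ Ω, ∀ z ∈ e.target, SubmeanAt (v ∘ e.symm) z

theorem IsHarmonic.neg {u : Ω → ℝ} (hu : IsHarmonic u) : IsHarmonic (-u) :=
  fun e he => (hu e he).neg

theorem IsHarmonic.isSubharmonic {u : Ω → ℝ} (hu : IsHarmonic u) : IsSubharmonic u :=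
  ⟨hu.continuous, fun e he z hz => (hu e he z hz).submeanAt⟩

theorem IsSubharmonic.add {u v : Ω → ℝ} (hu : IsSubharmonic u) (hv : IsSubharmonic v) :
    IsSubharmonic (u + v) :=
  ⟨hu.continuous.add hv.continuous, fun e he z hz =>
    (hu.submeanAt e he z hz).add (hv.submeanAt e he z hz)
      (eventually_continuousAt_comp_chart_symm hu.continuous hz)
      (eventually_continuousAt_comp_chart_symm hv.continuous hz)⟩

theorem IsSubharmonic.smul {u : Ω → ℝ} {c : ℝ} (hc : 0 ≤ c) (hu : IsSubharmonic u) :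
    IsSubharmonic (c • u) :=
  ⟨hu.continuous.const_smul c, fun e he z hz => (hu.submeanAt e he z hz).smul hc⟩

theorem IsSubharmonic.sup {u v : Ω → ℝ} (hu : IsSubharmonic u) (hv : IsSubharmonic v) :
    IsSubharmonic (u ⊔ v) := by
  have hc : Continuous (u ⊔ v) := hu.continuous.sup hv.continuous
  refine ⟨hc, fun e he z hz => ?_⟩
  have h3 := eventually_continuousAt_comp_chart_symm hc hz
  rcases le_total (u (e.symm z)) (v (e.symm z)) with h | h
  · exact (hv.submeanAt e he z hz).mono_of_eq (by simp [h])
      (Eventually.of_forall fun y => by simp)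
      (eventually_continuousAt_comp_chart_symm hv.continuous hz) h3
  · exact (hu.submeanAt e he z hz).mono_of_eq (by simp [h])
      (Eventually.of_forall fun y => by simp)
      (eventually_continuousAt_comp_chart_symm hu.continuous hz) h3

/-- The closed disc of centre `c` and radius `R` lies in the image of the chart `e`. -/
structure IsChartDisc (e : OpenPartialHomeomorph Ω ℂ) (c : ℂ) (R : ℝ) : Prop where
  mem_atlas : e ∈ atlas ℂ Ω
  pos : 0 < R
  subset_target : closedBall c R ⊆ e.target

theorem exists_isChartDisc {x : Ω} {U : Set Ω} (hU : U ∈ 𝓝 x) :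
    ∃ R, IsChartDisc (chartAt ℂ x) (chartAt ℂ x x) R ∧
      ∀ z ∈ closedBall (chartAt ℂ x x) R, (chartAt ℂ x).symm z ∈ U := by
  set e := chartAt ℂ x
  have hx : x ∈ e.source := mem_chart_source ℂ x
  have h1 : e.symm ⁻¹' U ∈ 𝓝 (e x) :=
    (e.continuousAt_symm (e.map_source hx)).preimage_mem_nhds (by rwa [e.left_inv hx])
  obtain ⟨ε, hε, h⟩ := Metric.nhds_basis_closedBall.mem_iff.1
    (inter_mem h1 (e.open_target.mem_nhds (e.map_source hx)))
  exact ⟨ε, ⟨chart_mem_atlas ℂ x, hε, fun z hz => (h hz).2⟩, fun z hz => (h hz).1⟩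

section Modification

variable {e : OpenPartialHomeomorph Ω ℂ} {c : ℂ} {R : ℝ}

theorem IsChartDisc.harmonicContOnCl_poissonModification (hD : IsChartDisc e c R) {v : Ω → ℝ}
    (hv : Continuous v) : HarmonicContOnCl (poissonModification e c R v ∘ e.symm) (ball c R) := by
  have h := harmonicContOnCl_poissonExtension (c := c) (R := R) (φ := v ∘ e.symm)
    ((continuousOn_comp_chart_symm hv e).mono (sphere_subset_closedBall.trans hD.subset_target))
  refine HarmonicContOnCl.mk_ball (fun z hz => ?_) (h.continuousOn_ball.congr fun z hz =>
    poissonModification_comp_symm (hD.subset_target hz))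
  refine (harmonicAt_congr_nhds ?_).1 (h.1 z hz)
  filter_upwards [isOpen_ball.mem_nhds hz] with y hy
  exact (poissonModification_comp_symm (hD.subset_target (ball_subset_closedBall hy))).symm

theorem IsChartDisc.continuous_poissonModification [T2Space Ω] (hD : IsChartDisc e c R)
    {v : Ω → ℝ} (hv : Continuous v) : Continuous (poissonModification e c R v) := by
  rw [continuous_iff_continuousAt]
  intro x
  by_cases hx : x ∈ e.source
  · have h1 := (continuousOn_poissonExtension hD.subset_target
      (continuousOn_comp_chart_symm hv e)).continuousAt (e.open_target.mem_nhds (e.map_source hx))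
    refine (h1.comp (e.continuousAt hx)).congr ?_
    filter_upwards [e.open_source.mem_nhds hx] with y hy
    rw [poissonModification, if_pos hy]; rfl
  · have hcl : IsClosed (e.symm '' closedBall c R) :=
      ((isCompact_closedBall c R).image_of_continuousOn
        (e.continuousOn_symm.mono hD.subset_target)).isClosed
    have hxn : x ∉ e.symm '' closedBall c R := by
      rintro ⟨z, hz, rfl⟩
      exact hx (e.map_target (hD.subset_target hz))
    refine hv.continuousAt.congr ?_
    filter_upwards [hcl.isOpen_compl.mem_nhds hxn] with y hy
    refine (poissonModification_of_notMem fun hys hyb => hy ?_).symm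
    exact ⟨e y, ball_subset_closedBall hyb, e.left_inv hys⟩

theorem IsChartDisc.le_poissonModification (hD : IsChartDisc e c R) {v : Ω → ℝ}
    (hv : IsSubharmonic v) : v ≤ poissonModification e c R v := by
  intro x
  by_cases h : x ∈ e.source → e x ∉ ball c R
  · exact (poissonModification_of_notMem h).ge
  · push Not at h
    obtain ⟨hx, hxb⟩ := h
    have := le_of_submeanAt_of_harmonicContOnCl
      ((continuousOn_comp_chart_symm hv.continuous e).mono hD.subset_target)
      (fun z hz => hv.submeanAt e hD.mem_atlas z (hD.subset_target (ball_subset_closedBall hz)))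
      (hD.harmonicContOnCl_poissonModification hv.continuous)
      (fun z hz => (by
        rw [Function.comp_apply, Function.comp_apply,
          poissonModification_comp_symm (hD.subset_target (sphere_subset_closedBall hz)),
          poissonExtension_of_notMem fun h' => (mem_ball.1 h').ne hz]
        rfl)) (e x) (ball_subset_closedBall hxb)
    simpa [e.left_inv hx] using this

theorem IsChartDisc.poissonModification_le (hD : IsChartDisc e c R) {v w : Ω → ℝ}
    (hv : Continuous v) (hw : IsSubharmonic (-w)) (hvw : v ≤ w) :
    poissonModification e c R v ≤ w := by
  intro x
  by_cases h : x ∈ e.source → e x ∉ ball c R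
  · exact (poissonModification_of_notMem h).trans_le (hvw x)
  · push Not at h
    obtain ⟨hx, hxb⟩ := h
    have hh := hD.harmonicContOnCl_poissonModification hv
    have := le_of_submeanAt_of_harmonicContOnCl
      (g := -(poissonModification e c R v ∘ e.symm))
      ((continuousOn_comp_chart_symm hw.continuous e).mono hD.subset_target)
      (fun z hz => hw.submeanAt e hD.mem_atlas z (hD.subset_target (ball_subset_closedBall hz)))
      (HarmonicContOnCl.mk_ball hh.1.neg hh.continuousOn_ball.neg)
      (fun z hz => (by
        rw [Pi.neg_apply, Function.comp_apply, Function.comp_apply,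
          poissonModification_comp_symm (hD.subset_target (sphere_subset_closedBall hz)),
          poissonExtension_of_notMem fun h' => (mem_ball.1 h').ne hz]
        exact neg_le_neg (hvw _))) (e x) (ball_subset_closedBall hxb)
    simpa [e.left_inv hx] using this

/-- Inside the disc the modification is harmonic; at the other points it has the same value as `v`,
and it is at least `v` everywhere. -/
theorem IsChartDisc.isSubharmonic_poissonModification [T2Space Ω] [IsManifold 𝓘(ℂ) ω Ω]
    (hD : IsChartDisc e c R) {v : Ω → ℝ} (hv : IsSubharmonic v) :
    IsSubharmonic (poissonModification e c R v) := by
  have hc := hD.continuous_poissonModification hv.continuous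
  refine ⟨hc, fun e' he' z hz => ?_⟩
  by_cases h : e'.symm z ∈ e.source → e (e'.symm z) ∉ ball c R
  · exact (hv.submeanAt e' he' z hz).mono_of_eq (poissonModification_of_notMem h).symm
      (Eventually.of_forall fun y => hD.le_poissonModification hv _)
      (eventually_continuousAt_comp_chart_symm hv.continuous hz)
      (eventually_continuousAt_comp_chart_symm hc hz)
  · push Not at h
    obtain ⟨hx, hxb⟩ := h
    have h1 := harmonicAt_chart_change hD.mem_atlas he' hx (e'.map_target hz)
      ((hD.harmonicContOnCl_poissonModification hv.continuous).1 _ hxb)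
    rw [e'.right_inv hz] at h1
    exact h1.submeanAt

end Modification

/-- The Perron family of `s`: the subharmonic functions which lie below every continuous
superharmonic majorant of `s`. -/
def perronFamily (s : Ω → ℝ) : Set (Ω → ℝ) :=
  {v | IsSubharmonic v ∧ ∀ w, IsSubharmonic (-w) → s ≤ w → v ≤ w}

/-- The least harmonic majorant of `s`, as the upper envelope of the Perron family. -/
noncomputable def leastHarmonicMajorant (s : Ω → ℝ) (x : Ω) : ℝ :=
  sSup ((fun v : Ω → ℝ => v x) '' perronFamily s)

section Perron

variable {s : Ω → ℝ}

theorem IsHarmonic.perronFamily_le {u v : Ω → ℝ} (hu : IsHarmonic u) (hsu : s ≤ u)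
    (hv : v ∈ perronFamily s) : v ≤ u := hv.2 u hu.neg.isSubharmonic hsu

theorem bddAbove_perronFamily (hm : (harmonicMajorants s).Nonempty) (x : Ω) :
    BddAbove ((fun v : Ω → ℝ => v x) '' perronFamily s) := by
  obtain ⟨u, hu, hsu⟩ := hm
  exact ⟨u x, by rintro _ ⟨v, hv, rfl⟩; exact hu.perronFamily_le hsu hv x⟩

theorem IsSubharmonic.mem_perronFamily (hs : IsSubharmonic s) : s ∈ perronFamily s :=
  ⟨hs, fun _ _ h => h⟩

theorem le_leastHarmonicMajorant_of_mem (hm : (harmonicMajorants s).Nonempty) {v : Ω → ℝ}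
    (hv : v ∈ perronFamily s) : v ≤ leastHarmonicMajorant s :=
  fun x => le_csSup (bddAbove_perronFamily hm x) ⟨v, hv, rfl⟩

/-- The majorant `w` need only be superharmonic here. -/
theorem leastHarmonicMajorant_le (hs : IsSubharmonic s) {w : Ω → ℝ} (hw : IsSubharmonic (-w))
    (hsw : s ≤ w) : leastHarmonicMajorant s ≤ w := fun x =>
  csSup_le ⟨_, s, hs.mem_perronFamily, rfl⟩ (by rintro _ ⟨v, hv, rfl⟩; exact hv.2 w hw hsw x)

theorem sup_mem_perronFamily {v w : Ω → ℝ} (hv : v ∈ perronFamily s) (hw : w ∈ perronFamily s) :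
    v ⊔ w ∈ perronFamily s :=
  ⟨hv.1.sup hw.1, fun g hg hsg => sup_le (hv.2 g hg hsg) (hw.2 g hg hsg)⟩

theorem harmonicMajorants_add_nonempty {t : Ω → ℝ} (hs : (harmonicMajorants s).Nonempty)
    (ht : (harmonicMajorants t).Nonempty) : (harmonicMajorants (s + t)).Nonempty := by
  obtain ⟨u, hu, hsu⟩ := hs
  obtain ⟨v, hv, htv⟩ := ht
  exact ⟨u + v, hu.add hv, add_le_add hsu htv⟩

/-- An increasing sequence in the Perron family whose terms are harmonic in a chart disc has a
limit which is harmonic there. -/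
theorem harmonicOnNhd_iSup_of_perronFamily (hm : (harmonicMajorants s).Nonempty)
    {e : OpenPartialHomeomorph Ω ℂ} {c : ℂ} {R : ℝ} (hD : IsChartDisc e c R) {V : ℕ → Ω → ℝ}
    (hV : ∀ n, V n ∈ perronFamily s) (hmono : Monotone V)
    (hh : ∀ n, HarmonicContOnCl (V n ∘ e.symm) (ball c R)) :
    HarmonicOnNhd ((fun x => ⨆ n, V n x) ∘ e.symm) (ball c R) := by
  obtain ⟨u, hu, hsu⟩ := hm
  have hc : ∀ v : Ω → ℝ, Continuous v → ∃ C, ∀ z ∈ closedBall c R, ‖v (e.symm z)‖ ≤ C :=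
    fun v hv => (isCompact_closedBall c R).exists_bound_of_continuousOn
      ((continuousOn_comp_chart_symm hv e).mono hD.subset_target)
  obtain ⟨C₁, hC₁⟩ := hc (V 0) (hV 0).1.continuous
  obtain ⟨C₂, hC₂⟩ := hc u hu.continuous
  refine harmonicOnNhd_of_tendsto (C := max C₁ C₂) hh (fun n z hz => ?_) fun z hz => ?_
  · have hz' := sphere_subset_closedBall hz
    have h1 := (abs_le.1 (hC₁ z hz')).1
    have h2 := (abs_le.1 (hC₂ z hz')).2
    have h3 : V 0 (e.symm z) ≤ V n (e.symm z) := hmono (Nat.zero_le n) _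
    have h4 := hu.perronFamily_le hsu (hV n) (e.symm z)
    have h5 := le_max_left C₁ C₂
    have h6 := le_max_right C₁ C₂
    exact abs_le.2 ⟨by simp only [Function.comp_apply]; linarith,
      by simp only [Function.comp_apply]; linarith⟩
  · refine tendsto_atTop_ciSup (fun m n h => hmono h _) ⟨u (e.symm z), ?_⟩
    rintro _ ⟨n, rfl⟩
    exact hu.perronFamily_le hsu (hV n) _

variable [T2Space Ω] [IsManifold 𝓘(ℂ) ω Ω]

theorem IsChartDisc.poissonModification_mem_perronFamily {e : OpenPartialHomeomorph Ω ℂ} {c : ℂ}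
    {R : ℝ} (hD : IsChartDisc e c R) {v : Ω → ℝ} (hv : v ∈ perronFamily s) :
    poissonModification e c R v ∈ perronFamily s :=
  ⟨hD.isSubharmonic_poissonModification hv.1, fun w hw hsw =>
    hD.poissonModification_le hv.1.continuous hw (hv.2 w hw hsw)⟩

/-- Any sequence in the Perron family lies below an increasing sequence in it whose terms are
harmonic in a given chart disc. -/
theorem IsChartDisc.exists_monotone_seq_perronFamily {e : OpenPartialHomeomorph Ω ℂ} {c : ℂ} {R : ℝ}
    (hD : IsChartDisc e c R) {f : ℕ → Ω → ℝ} (hf : ∀ n, f n ∈ perronFamily s) :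
    ∃ V : ℕ → Ω → ℝ, (∀ n, V n ∈ perronFamily s) ∧ Monotone V ∧
      (∀ n, HarmonicContOnCl (V n ∘ e.symm) (ball c R)) ∧ ∀ n, f n ≤ V n := by
  set M := poissonModification e c R with hM
  have hMF : ∀ {v}, v ∈ perronFamily s → M v ∈ perronFamily s :=
    fun hv => hD.poissonModification_mem_perronFamily hv
  have hMle : ∀ {v}, v ∈ perronFamily s → v ≤ M v := fun hv => hD.le_poissonModification hv.1
  have hMh : ∀ {v}, v ∈ perronFamily s → HarmonicContOnCl (M v ∘ e.symm) (ball c R) :=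
    fun hv => hD.harmonicContOnCl_poissonModification hv.1.continuous
  let V : ℕ → Ω → ℝ := fun n => Nat.rec (M (f 0)) (fun k Vk => M (Vk ⊔ f (k + 1))) n
  have hVs : ∀ n, V (n + 1) = M (V n ⊔ f (n + 1)) := fun n => rfl
  have hVF : ∀ n, V n ∈ perronFamily s := by
    intro n
    induction n with
    | zero => exact hMF (hf 0)
    | succ n ih => rw [hVs]; exact hMF (sup_mem_perronFamily ih (hf _))
  have hVle : ∀ n, V n ⊔ f (n + 1) ≤ V (n + 1) := fun n =>
    hMle (sup_mem_perronFamily (hVF n) (hf _))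
  refine ⟨V, hVF, monotone_nat_of_le_succ fun n => le_sup_left.trans (hVle n), ?_, ?_⟩
  · rintro (_ | n)
    · exact hMh (hf 0)
    · rw [hVs]; exact hMh (sup_mem_perronFamily (hVF n) (hf _))
  · rintro (_ | n)
    · exact hMle (hf 0)
    · exact le_sup_right.trans (hVle n)

/-- **Perron's theorem**, in a chart disc. -/
theorem IsChartDisc.harmonicOnNhd_leastHarmonicMajorant (hs : IsSubharmonic s)
    (hm : (harmonicMajorants s).Nonempty) {e : OpenPartialHomeomorph Ω ℂ} {c : ℂ} {R : ℝ}
    (hD : IsChartDisc e c R) :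
    HarmonicOnNhd (leastHarmonicMajorant s ∘ e.symm) (ball c R) := by
  have hbdd : ∀ {V : ℕ → Ω → ℝ}, (∀ n, V n ∈ perronFamily s) → ∀ x,
      BddAbove (range fun n => V n x) := fun h x =>
    (bddAbove_perronFamily hm x).mono (by rintro _ ⟨n, rfl⟩; exact ⟨_, h n, rfl⟩)
  have hle : ∀ {V : ℕ → Ω → ℝ}, (∀ n, V n ∈ perronFamily s) → ∀ x,
      ⨆ n, V n x ≤ leastHarmonicMajorant s x := fun h x =>
    ciSup_le fun n => le_leastHarmonicMajorant_of_mem hm (h n) x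
  -- an increasing sequence `V` whose limit has the right value at the centre of the disc
  obtain ⟨y, -, hy, hyS⟩ := exists_seq_tendsto_sSup
    (S := (fun v : Ω → ℝ => v (e.symm c)) '' perronFamily s) ⟨_, s, hs.mem_perronFamily, rfl⟩
    (bddAbove_perronFamily hm _)
  choose v hv hvy using hyS
  obtain ⟨V, hVF, hVm, hVh, hvV⟩ := hD.exists_monotone_seq_perronFamily hv
  have hcen : leastHarmonicMajorant s (e.symm c) ≤ ⨆ n, V n (e.symm c) := by
    refine le_of_tendsto hy (Eventually.of_forall fun n => ?_)
    rw [← hvy n]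
    exact (hvV n _).trans (le_ciSup (hbdd hVF _) n)
  have hW := harmonicOnNhd_iSup_of_perronFamily hm hD hVF hVm hVh
  -- the limit of `V` is the upper envelope in the whole disc
  have hkey : ∀ z ∈ ball c R, leastHarmonicMajorant s (e.symm z) = ⨆ n, V n (e.symm z) := by
    intro z hz
    refine le_antisymm (csSup_le ⟨_, s, hs.mem_perronFamily, rfl⟩ ?_) (hle hVF _)
    rintro _ ⟨g, hg, rfl⟩
    obtain ⟨V', hV'F, hV'm, hV'h, hgV'⟩ := hD.exists_monotone_seq_perronFamily
      fun n => sup_mem_perronFamily (hVF n) hg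
    have hW' := harmonicOnNhd_iSup_of_perronFamily hm hD hV'F hV'm hV'h
    have hVV' : ∀ x, ⨆ n, V n x ≤ ⨆ n, V' n x := fun x =>
      ciSup_mono (hbdd hV'F x) fun n => le_sup_left.trans (hgV' n) x
    -- the two limits agree at the centre, and their difference is nonnegative and harmonic
    have h0 := eq_zero_of_nonneg_of_center_eq_zero (hW'.sub hW)
      (fun y _ => sub_nonneg.2 (hVV' (e.symm y)))
      (sub_eq_zero.2 (le_antisymm ((hle hV'F _).trans hcen) (hVV' _))) z hz
    calc g (e.symm z) ≤ V' 0 (e.symm z) := (le_sup_right.trans (hgV' 0)) (e.symm z)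
      _ ≤ ⨆ n, V' n (e.symm z) := le_ciSup (hbdd hV'F _) 0
      _ = ⨆ n, V n (e.symm z) := sub_eq_zero.1 h0
  intro z hz
  refine (harmonicAt_congr_nhds ?_).1 (hW z hz)
  filter_upwards [isOpen_ball.mem_nhds hz] with x hx
  exact (hkey x hx).symm

theorem isHarmonic_leastHarmonicMajorant (hs : IsSubharmonic s)
    (hm : (harmonicMajorants s).Nonempty) : IsHarmonic (leastHarmonicMajorant s) := by
  refine isHarmonic_of_forall_exists_chart fun x => ?_
  obtain ⟨R, hD, -⟩ := exists_isChartDisc (x := x) univ_mem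
  exact ⟨_, hD.mem_atlas, mem_chart_source ℂ x,
    hD.harmonicOnNhd_leastHarmonicMajorant hs hm _ (mem_ball_self hD.pos)⟩

theorem isLeast_leastHarmonicMajorant (hs : IsSubharmonic s)
    (hm : (harmonicMajorants s).Nonempty) :
    IsLeast (harmonicMajorants s) (leastHarmonicMajorant s) :=
  ⟨⟨isHarmonic_leastHarmonicMajorant hs hm, le_leastHarmonicMajorant_of_mem hm hs.mem_perronFamily⟩,
    fun _ hu => leastHarmonicMajorant_le hs hu.1.neg.isSubharmonic hu.2⟩

/-- Least harmonic majorants of subharmonic functions are additive. If `U` majorizes `s + t`, then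
the superharmonic function `U - t` majorizes `s`, hence also the least harmonic majorant of `s`. -/
theorem leastHarmonicMajorant_add {t : Ω → ℝ} (hs : IsSubharmonic s) (ht : IsSubharmonic t)
    (hsm : (harmonicMajorants s).Nonempty) (htm : (harmonicMajorants t).Nonempty) :
    leastHarmonicMajorant (s + t) = leastHarmonicMajorant s + leastHarmonicMajorant t := by
  have hS := isLeast_leastHarmonicMajorant hs hsm
  have hT := isLeast_leastHarmonicMajorant ht htm
  have hU := isLeast_leastHarmonicMajorant (hs.add ht) (harmonicMajorants_add_nonempty hsm htm)
  refine le_antisymm (hU.2 ⟨hS.1.1.add hT.1.1, add_le_add hS.1.2 hT.1.2⟩) ?_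
  set U := leastHarmonicMajorant (s + t)
  have h1 : leastHarmonicMajorant s ≤ U + -t := by
    refine leastHarmonicMajorant_le hs ?_ ?_
    · rw [neg_add, neg_neg]
      exact hU.1.1.neg.isSubharmonic.add ht
    · intro x
      have : s x + t x ≤ U x := hU.1.2 x
      simp only [Pi.add_apply, Pi.neg_apply]; linarith
  have h2 : leastHarmonicMajorant t ≤ U + -leastHarmonicMajorant s := by
    refine hT.2 ⟨hU.1.1.add hS.1.1.neg, fun x => ?_⟩
    have := h1 x
    simp only [Pi.add_apply, Pi.neg_apply] at this ⊢; linarith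
  intro x
  have := h2 x
  simp only [Pi.add_apply, Pi.neg_apply] at this ⊢; linarith

theorem leastHarmonicMajorant_smul {c : ℝ} (hc : 0 ≤ c) (hs : IsSubharmonic s)
    (hm : (harmonicMajorants s).Nonempty) :
    leastHarmonicMajorant (c • s) = c • leastHarmonicMajorant s := by
  have hS := isLeast_leastHarmonicMajorant hs hm
  have hmem : c • leastHarmonicMajorant s ∈ harmonicMajorants (c • s) :=
    ⟨hS.1.1.const_smul c, smul_le_smul_of_nonneg_left hS.1.2 hc⟩
  have hL := isLeast_leastHarmonicMajorant (hs.smul hc) ⟨_, hmem⟩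
  refine le_antisymm (hL.2 hmem) ?_
  rcases hc.eq_or_lt with rfl | hc
  · rw [zero_smul]
    intro x
    simpa using hL.1.2 x
  · have h1 : leastHarmonicMajorant s ≤ c⁻¹ • leastHarmonicMajorant (c • s) := by
      refine hS.2 ⟨hL.1.1.const_smul _, ?_⟩
      have := smul_le_smul_of_nonneg_left hL.1.2 (inv_pos.2 hc).le
      rwa [inv_smul_smul₀ hc.ne'] at this
    have := smul_le_smul_of_nonneg_left h1 hc.le
    rwa [smul_inv_smul₀ hc.ne'] at this

end Perron

section Harnack

theorem exists_nhds_harnack_local (x : Ω) : ∃ U ∈ 𝓝 x, ∀ u : Ω → ℝ, IsHarmonic u → 0 ≤ u →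
    ∀ y ∈ U, u y ≤ 3 * u x ∧ u x ≤ 3 * u y := by
  obtain ⟨R, hD, -⟩ := exists_isChartDisc (x := x) univ_mem
  set e := chartAt ℂ x
  have hx : x ∈ e.source := mem_chart_source ℂ x
  refine ⟨e.source ∩ e ⁻¹' ball (e x) (R / 2), inter_mem (e.open_source.mem_nhds hx)
    ((e.continuousAt hx).preimage_mem_nhds (ball_mem_nhds _ (half_pos hD.pos))),
    fun u hu hnn y hy => ?_⟩
  have h1 := (hu e hD.mem_atlas).mono hD.subset_target
  have := harnack_of_nonneg (HarmonicContOnCl.mk_ball (h1.mono ball_subset_closedBall)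
    h1.continuousOn) (fun z _ => hnn (e.symm z)) hy.2
  simpa [e.left_inv hx, e.left_inv hy.1] using this

/-- **Harnack's inequality** on a connected surface. -/
theorem exists_nhds_harnack [ConnectedSpace Ω] (a x : Ω) : ∃ U ∈ 𝓝 x, ∃ C : ℝ, 0 ≤ C ∧
    ∀ u : Ω → ℝ, IsHarmonic u → 0 ≤ u → ∀ y ∈ U, u y ≤ C * u a := by
  -- the set of points where some constant works is open and closed
  set A : Set Ω := {x | ∃ C : ℝ, 0 ≤ C ∧ ∀ u : Ω → ℝ, IsHarmonic u → 0 ≤ u → u x ≤ C * u a}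
  have hop : IsOpen A := by
    refine isOpen_iff_mem_nhds.2 fun x ⟨C, hC, h⟩ => ?_
    obtain ⟨U, hU, hUh⟩ := exists_nhds_harnack_local x
    refine mem_of_superset hU fun y hy => ⟨3 * C, by positivity, fun u hu hnn => ?_⟩
    linarith [(hUh u hu hnn y hy).1, h u hu hnn]
  have hcl : IsClosed A := by
    refine ⟨isOpen_iff_mem_nhds.2 fun x hx => ?_⟩
    obtain ⟨U, hU, hUh⟩ := exists_nhds_harnack_local x
    refine mem_of_superset hU fun y hy ⟨C, hC, h⟩ => hx ⟨3 * C, by positivity, fun u hu hnn => ?_⟩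
    linarith [(hUh u hu hnn y hy).2, h u hu hnn]
  have huniv : A = univ := IsClopen.eq_univ ⟨hcl, hop⟩ ⟨a, 1, zero_le_one, fun u _ _ => by simp⟩
  obtain ⟨C, hC, h⟩ : x ∈ A := huniv ▸ mem_univ x
  obtain ⟨U, hU, hUh⟩ := exists_nhds_harnack_local x
  refine ⟨U, hU, 3 * C, by positivity, fun u hu hnn y hy => ?_⟩
  linarith [(hUh u hu hnn y hy).1, h u hu hnn]

theorem IsHarmonic.eq_zero_of_nonneg [ConnectedSpace Ω] {u : Ω → ℝ} (hu : IsHarmonic u)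
    (hnn : 0 ≤ u) {a : Ω} (ha : u a = 0) : u = 0 := by
  funext x
  obtain ⟨U, hU, C, -, h⟩ := exists_nhds_harnack a x
  refine le_antisymm ?_ (hnn x)
  simpa [ha] using h u hu hnn x (mem_of_mem_nhds hU)

/-- **Harnack's principle** for series of positive terms. -/
theorem isHarmonic_tsum_of_nonneg [ConnectedSpace Ω] [IsManifold 𝓘(ℂ) ω Ω] {v : ℕ → Ω → ℝ} {a : Ω}
    (hv : ∀ k, IsHarmonic (v k)) (hnn : ∀ k, 0 ≤ v k) (ha : Summable fun k => v k a) :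
    (∀ x, Summable fun k => v k x) ∧ IsHarmonic fun x => ∑' k, v k x := by
  have hsum : ∀ x, Summable fun k => v k x := fun x => by
    obtain ⟨U, hU, C, -, h⟩ := exists_nhds_harnack a x
    exact Summable.of_nonneg_of_le (fun k => hnn k x)
      (fun k => h _ (hv k) (hnn k) x (mem_of_mem_nhds hU)) (ha.mul_left C)
  refine ⟨hsum, isHarmonic_of_forall_exists_chart fun x => ?_⟩
  obtain ⟨U, hU, C, hC, h⟩ := exists_nhds_harnack a x
  obtain ⟨R, hD, hDU⟩ := exists_isChartDisc hU
  refine ⟨_, hD.mem_atlas, mem_chart_source ℂ x, ?_⟩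
  have hpart : ∀ n, IsHarmonic (∑ k ∈ Finset.range n, v k) := fun n => by
    induction n with
    | zero => simpa using isHarmonic_zero
    | succ n ih => rw [Finset.sum_range_succ]; exact ih.add (hv n)
  refine harmonicOnNhd_of_tendsto (C := C * ∑' k, v k a)
    (V := fun n => (∑ k ∈ Finset.range n, v k) ∘ (chartAt ℂ x).symm)
    (fun n => ?_) (fun n z hz => ?_) (fun z hz => ?_) _ (mem_ball_self hD.pos)
  · have h1 := (hpart n _ hD.mem_atlas).mono hD.subset_target
    exact HarmonicContOnCl.mk_ball (h1.mono ball_subset_closedBall) h1.continuousOn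
  · have h2 : (0 : Ω → ℝ) ≤ ∑ k ∈ Finset.range n, v k := Finset.sum_nonneg fun k _ => hnn k
    rw [Function.comp_apply, abs_of_nonneg (h2 _)]
    refine (h _ (hpart n) h2 _ (hDU z (sphere_subset_closedBall hz))).trans ?_
    refine mul_le_mul_of_nonneg_left ?_ hC
    rw [Finset.sum_apply]
    exact ha.sum_le_tsum _ fun k _ => hnn k a
  · simpa [Function.comp_def] using (hsum ((chartAt ℂ x).symm z)).hasSum.tendsto_sum_nat

end Harnack

end SurfacePotentialTheory

/-! ### Analytic functions on a surface and the orders of their zeros -/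

section AnalyticFunctions

open Metric Set Filter Topology

/-- Iterated derivatives of locally uniform limits of analytic functions converge. -/
theorem TendstoLocallyUniformlyOn.iteratedDeriv_of_differentiableOn {F : ℕ → ℂ → ℂ} {f : ℂ → ℂ}
    {U : Set ℂ} (hU : IsOpen U) (hF : ∀ n, DifferentiableOn ℂ (F n) U)
    (h : TendstoLocallyUniformlyOn F f atTop U) (k : ℕ) :
    TendstoLocallyUniformlyOn (fun n => iteratedDeriv k (F n)) (iteratedDeriv k f) atTop U ∧
      ∀ n, DifferentiableOn ℂ (iteratedDeriv k (F n)) U := by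
  induction k with
  | zero => simpa [iteratedDeriv_zero] using ⟨h, hF⟩
  | succ k ih =>
    simp only [iteratedDeriv_succ]
    exact ⟨ih.1.deriv (Eventually.of_forall ih.2) hU, fun n => (ih.2 n).deriv hU⟩

variable {Ω : Type*} [TopologicalSpace Ω] [ChartedSpace ℂ Ω]

theorem zeroOrder_eq_top_iff_eventually {a : Ω} {f : Ω → ℂ} :
    zeroOrder a f = ⊤ ↔ ∀ᶠ x in 𝓝 a, f x = 0 := by
  have ha := mem_chart_source ℂ a
  rw [zeroOrder, analyticOrderAt_eq_top, ← (chartAt ℂ a).map_nhds_eq ha, eventually_map]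
  refine eventually_congr ?_
  filter_upwards [(chartAt ℂ a).open_source.mem_nhds ha] with y hy
  simp [(chartAt ℂ a).left_inv hy]

theorem min_le_zeroOrder_add (a : Ω) (f g : Ω → ℂ) :
    min (zeroOrder a f) (zeroOrder a g) ≤ zeroOrder a (f + g) :=
  le_analyticOrderAt_add

theorem zeroOrder_eq_zero_of_ne {a : Ω} {f : Ω → ℂ} (h : f a ≠ 0) : zeroOrder a f = 0 :=
  analyticOrderAt_eq_zero.2 (Or.inr (by simpa using h))

variable [IsManifold 𝓘(ℂ) ω Ω]

theorem MDifferentiable.analyticOnNhd_comp_chart_symm {f : Ω → ℂ}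
    (hf : MDifferentiable 𝓘(ℂ) 𝓘(ℂ) f) {e : OpenPartialHomeomorph Ω ℂ} (he : e ∈ atlas ℂ Ω) :
    AnalyticOnNhd ℂ (f ∘ e.symm) e.target := by
  refine DifferentiableOn.analyticOnNhd (fun z hz => ?_) e.open_target
  have h1 : MDifferentiableAt 𝓘(ℂ) 𝓘(ℂ) e.symm z :=
    ((contMDiffOn_symm_of_mem_maximalAtlas (I := 𝓘(ℂ)) (n := ω)
      (IsManifold.subset_maximalAtlas he)).contMDiffAt
      (e.open_target.mem_nhds hz)).mdifferentiableAt (by simp)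
  exact (((hf _).comp z h1).differentiableAt).differentiableWithinAt

theorem mdifferentiable_of_differentiableAt_chart {f : Ω → ℂ}
    (hf : ∀ x, DifferentiableAt ℂ (f ∘ (chartAt ℂ x).symm) (chartAt ℂ x x)) :
    MDifferentiable 𝓘(ℂ) 𝓘(ℂ) f := by
  intro x
  have hx := mem_chart_source ℂ x
  have h1 : MDifferentiableAt 𝓘(ℂ) 𝓘(ℂ) (chartAt ℂ x) x :=
    ((contMDiffOn_of_mem_maximalAtlas (I := 𝓘(ℂ)) (n := ω)
      (IsManifold.subset_maximalAtlas (chart_mem_atlas ℂ x))).contMDiffAt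
      ((chartAt ℂ x).open_source.mem_nhds hx)).mdifferentiableAt (by simp)
  refine ((hf x).mdifferentiableAt.comp x h1).congr_of_eventuallyEq ?_
  filter_upwards [(chartAt ℂ x).open_source.mem_nhds hx] with y hy
  simp [(chartAt ℂ x).left_inv hy]

theorem MDifferentiable.analyticAt_chart {f : Ω → ℂ} (hf : MDifferentiable 𝓘(ℂ) 𝓘(ℂ) f) (a : Ω) :
    AnalyticAt ℂ (f ∘ (chartAt ℂ a).symm) (chartAt ℂ a a) :=
  hf.analyticOnNhd_comp_chart_symm (chart_mem_atlas ℂ a) _ (mem_chart_target ℂ a)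

/-- The square modulus of an analytic function is subharmonic. -/
theorem MDifferentiable.isSubharmonic_norm_sq {f : Ω → ℂ} (hf : MDifferentiable 𝓘(ℂ) 𝓘(ℂ) f) :
    IsSubharmonic fun x => ‖f x‖ ^ 2 :=
  ⟨hf.continuous.norm.pow 2, fun _ he z hz =>
    submeanAt_norm_sq (hf.analyticOnNhd_comp_chart_symm he z hz)⟩

/-- The identity theorem on a connected surface. -/
theorem MDifferentiable.zeroOrder_eq_top_iff [ConnectedSpace Ω] {f : Ω → ℂ}
    (hf : MDifferentiable 𝓘(ℂ) 𝓘(ℂ) f) (a : Ω) : zeroOrder a f = ⊤ ↔ f = 0 := by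
  rw [zeroOrder_eq_top_iff_eventually]
  refine ⟨fun h => ?_, fun h => by simp [h]⟩
  set A : Set Ω := {x | ∀ᶠ y in 𝓝 x, f y = 0}
  have hop : IsOpen A := isOpen_iff_mem_nhds.2 fun x hx => eventually_eventually_nhds.2 hx
  have hcl : IsClosed A := by
    refine isClosed_of_closure_subset fun x hx => ?_
    have hxs := mem_chart_source ℂ x
    set e := chartAt ℂ x
    have hsrc := e.open_source.mem_nhds hxs
    rcases (hf.analyticAt_chart x).eventually_eq_zero_or_eventually_ne_zero with h0 | h0
    · exact zeroOrder_eq_top_iff_eventually.1 (analyticOrderAt_eq_top.2 h0)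
    · rw [eventually_nhdsWithin_iff, ← e.map_nhds_eq hxs, eventually_map] at h0
      obtain ⟨y, ⟨hy, hys⟩, hyA⟩ := mem_closure_iff_nhds.1 hx _ (inter_mem h0 hsrc)
      rcases eq_or_ne y x with rfl | hyx
      · exact hyA
      · refine absurd (hyA.self_of_nhds) ?_
        have := hy fun h' => hyx (e.injOn hys hxs h')
        simpa [e, e.left_inv hys] using this
  have huniv : A = univ := IsClopen.eq_univ ⟨hcl, hop⟩ ⟨a, h⟩
  funext x
  exact (huniv ▸ mem_univ x : x ∈ A).self_of_nhds

theorem zeroOrder_mul {f g : Ω → ℂ} (hf : MDifferentiable 𝓘(ℂ) 𝓘(ℂ) f)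
    (hg : MDifferentiable 𝓘(ℂ) 𝓘(ℂ) g) (a : Ω) :
    zeroOrder a (f * g) = zeroOrder a f + zeroOrder a g :=
  analyticOrderAt_mul (hf.analyticAt_chart a) (hg.analyticAt_chart a)

theorem one_le_zeroOrder {f : Ω → ℂ} (hf : MDifferentiable 𝓘(ℂ) 𝓘(ℂ) f) {a : Ω} (h : f a = 0) :
    1 ≤ zeroOrder a f :=
  Order.one_le_iff_ne_zero.2 (analyticOrderAt_ne_zero.2 ⟨hf.analyticAt_chart a, by simpa using h⟩)

theorem zeroOrder_const_smul {f : Ω → ℂ} (hf : MDifferentiable 𝓘(ℂ) 𝓘(ℂ) f) (a : Ω) {c : ℂ}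
    (hc : c ≠ 0) : zeroOrder a (c • f) = zeroOrder a f := by
  have h : c • f = (fun _ => c) * f := rfl
  rw [h, zeroOrder_mul mdifferentiable_const hf, zeroOrder_eq_zero_of_ne (by exact hc), zero_add]

/-- Orders of zeros do not drop in locally uniform limits. -/
theorem le_zeroOrder_of_tendstoUniformlyOn {f : ℕ → Ω → ℂ} {g : Ω → ℂ} {a : Ω} {U : Set Ω}
    (hf : ∀ n, MDifferentiable 𝓘(ℂ) 𝓘(ℂ) (f n)) (hg : MDifferentiable 𝓘(ℂ) 𝓘(ℂ) g)
    (hU : U ∈ 𝓝 a) (h : TendstoUniformlyOn f g atTop U) {k : ℕ}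
    (hk : ∀ n, (k : ℕ∞) ≤ zeroOrder a (f n)) : (k : ℕ∞) ≤ zeroOrder a g := by
  obtain ⟨R, hD, hDU⟩ := exists_isChartDisc hU
  set e := chartAt ℂ a
  have hunif : TendstoUniformlyOn (fun n => f n ∘ e.symm) (g ∘ e.symm) atTop
      (ball (e a) R) := fun u hu => by
    filter_upwards [h u hu] with n hn z hz
    exact hn _ (hDU z (ball_subset_closedBall hz))
  have key := fun i => (hunif.tendstoLocallyUniformlyOn.iteratedDeriv_of_differentiableOn isOpen_ball
    (fun n => ((hf n).analyticOnNhd_comp_chart_symm hD.mem_atlas).differentiableOn.mono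
      (ball_subset_closedBall.trans hD.subset_target)) i).1.tendsto_at (mem_ball_self hD.pos)
  rw [zeroOrder, natCast_le_analyticOrderAt_iff_iteratedDeriv_eq_zero (hg.analyticAt_chart a)]
  intro i hi
  refine tendsto_nhds_unique (key i) (tendsto_const_nhds.congr fun n => ?_)
  exact ((natCast_le_analyticOrderAt_iff_iteratedDeriv_eq_zero
    ((hf n).analyticAt_chart a)).1 (hk n) i hi).symm

end AnalyticFunctions

/-! ### The inner product of H² -/

section HardySpace

open Metric Set Filter Topology ComplexConjugate

variable {Ω : Type*} [TopologicalSpace Ω] [ChartedSpace ℂ Ω]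

/-- The cone of the continuous subharmonic functions which have a harmonic majorant. -/
def majorizedSubharmonic (Ω : Type*) [TopologicalSpace Ω] [ChartedSpace ℂ Ω] : Set (Ω → ℝ) :=
  {s | IsSubharmonic s ∧ (harmonicMajorants s).Nonempty}

theorem add_mem_majorizedSubharmonic {s t : Ω → ℝ} (hs : s ∈ majorizedSubharmonic Ω)
    (ht : t ∈ majorizedSubharmonic Ω) : s + t ∈ majorizedSubharmonic Ω :=
  ⟨hs.1.add ht.1, harmonicMajorants_add_nonempty hs.2 ht.2⟩

theorem smul_mem_majorizedSubharmonic {s : Ω → ℝ} {c : ℝ} (hc : 0 ≤ c)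
    (hs : s ∈ majorizedSubharmonic Ω) : c • s ∈ majorizedSubharmonic Ω := by
  obtain ⟨hs, u, hu, hsu⟩ := hs
  exact ⟨hs.smul hc, c • u, hu.const_smul c, smul_le_smul_of_nonneg_left hsu hc⟩

theorem zero_mem_majorizedSubharmonic : (0 : Ω → ℝ) ∈ majorizedSubharmonic Ω :=
  ⟨isHarmonic_zero.isSubharmonic, 0, isHarmonic_zero, le_rfl⟩

/-- `f` is a difference of two functions of the cone `majorizedSubharmonic Ω`. -/
def IsMajorizedDifference (f : Ω → ℝ) : Prop :=
  ∃ s ∈ majorizedSubharmonic Ω, ∃ t ∈ majorizedSubharmonic Ω, f = s - t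

theorem IsMajorizedDifference.of_mem {s : Ω → ℝ} (hs : s ∈ majorizedSubharmonic Ω) :
    IsMajorizedDifference s := ⟨s, hs, 0, zero_mem_majorizedSubharmonic, (sub_zero s).symm⟩

theorem IsMajorizedDifference.add {f g : Ω → ℝ} (hf : IsMajorizedDifference f)
    (hg : IsMajorizedDifference g) : IsMajorizedDifference (f + g) := by
  obtain ⟨s, hs, t, ht, rfl⟩ := hf
  obtain ⟨s', hs', t', ht', rfl⟩ := hg
  exact ⟨_, add_mem_majorizedSubharmonic hs hs', _, add_mem_majorizedSubharmonic ht ht', by abel⟩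

theorem IsMajorizedDifference.neg {f : Ω → ℝ} (hf : IsMajorizedDifference f) :
    IsMajorizedDifference (-f) := by
  obtain ⟨s, hs, t, ht, rfl⟩ := hf
  exact ⟨t, ht, s, hs, neg_sub _ _⟩

theorem IsMajorizedDifference.smul {f : Ω → ℝ} (c : ℝ) (hf : IsMajorizedDifference f) :
    IsMajorizedDifference (c • f) := by
  have hpos : ∀ {c : ℝ}, 0 ≤ c → IsMajorizedDifference (c • f) := fun {c} hc => by
    obtain ⟨s, hs, t, ht, rfl⟩ := hf
    exact ⟨_, smul_mem_majorizedSubharmonic hc hs, _, smul_mem_majorizedSubharmonic hc ht,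
      smul_sub _ _ _⟩
  rcases le_total 0 c with hc | hc
  · exact hpos hc
  · simpa using (hpos (neg_nonneg.2 hc)).neg

open Classical in
/-- The linear extension of `s ↦ u_s(a)`, where `u_s` is the least harmonic majorant of `s`, to the
differences of majorized subharmonic functions (and `0` on all other functions). -/
noncomputable def majorantFunctional (a : Ω) (f : Ω → ℝ) : ℝ :=
  if h : IsMajorizedDifference f then
    leastHarmonicMajorant h.choose a - leastHarmonicMajorant h.choose_spec.2.choose a
  else 0

section Functional

variable [T2Space Ω] [IsManifold 𝓘(ℂ) ω Ω]

theorem majorantFunctional_sub (a : Ω) {s t : Ω → ℝ} (hs : s ∈ majorizedSubharmonic Ω)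
    (ht : t ∈ majorizedSubharmonic Ω) :
    majorantFunctional a (s - t) = leastHarmonicMajorant s a - leastHarmonicMajorant t a := by
  have h : IsMajorizedDifference (s - t) := ⟨s, hs, t, ht, rfl⟩
  rw [majorantFunctional, dif_pos h]
  set s' := h.choose
  have hs' : s' ∈ majorizedSubharmonic Ω := h.choose_spec.1
  set t' := h.choose_spec.2.choose
  have ht' : t' ∈ majorizedSubharmonic Ω := h.choose_spec.2.choose_spec.1
  have heq : s - t = s' - t' := h.choose_spec.2.choose_spec.2
  have h1 := leastHarmonicMajorant_add hs.1 ht'.1 hs.2 ht'.2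
  have h2 := leastHarmonicMajorant_add hs'.1 ht.1 hs'.2 ht.2
  rw [sub_eq_sub_iff_add_eq_add.1 heq, h2] at h1
  have := congrFun h1 a
  simp only [Pi.add_apply] at this
  linarith

theorem leastHarmonicMajorant_zero : leastHarmonicMajorant (0 : Ω → ℝ) = 0 := by
  simpa using leastHarmonicMajorant_smul (le_refl (0 : ℝ)) isHarmonic_zero.isSubharmonic
    (zero_mem_majorizedSubharmonic (Ω := Ω)).2

theorem majorantFunctional_of_mem (a : Ω) {s : Ω → ℝ} (hs : s ∈ majorizedSubharmonic Ω) :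
    majorantFunctional a s = leastHarmonicMajorant s a := by
  simpa [leastHarmonicMajorant_zero] using
    majorantFunctional_sub a hs zero_mem_majorizedSubharmonic

theorem majorantFunctional_add (a : Ω) {f g : Ω → ℝ} (hf : IsMajorizedDifference f)
    (hg : IsMajorizedDifference g) :
    majorantFunctional a (f + g) = majorantFunctional a f + majorantFunctional a g := by
  obtain ⟨s, hs, t, ht, rfl⟩ := hf
  obtain ⟨s', hs', t', ht', rfl⟩ := hg
  rw [sub_add_sub_comm, majorantFunctional_sub a (add_mem_majorizedSubharmonic hs hs')
    (add_mem_majorizedSubharmonic ht ht'), majorantFunctional_sub a hs ht,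
    majorantFunctional_sub a hs' ht', leastHarmonicMajorant_add hs.1 hs'.1 hs.2 hs'.2,
    leastHarmonicMajorant_add ht.1 ht'.1 ht.2 ht'.2]
  simp only [Pi.add_apply]; ring

theorem majorantFunctional_neg (a : Ω) {f : Ω → ℝ} (hf : IsMajorizedDifference f) :
    majorantFunctional a (-f) = -majorantFunctional a f := by
  obtain ⟨s, hs, t, ht, rfl⟩ := hf
  rw [neg_sub, majorantFunctional_sub a hs ht, majorantFunctional_sub a ht hs, neg_sub]

theorem majorantFunctional_smul (a : Ω) (c : ℝ) {f : Ω → ℝ} (hf : IsMajorizedDifference f) :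
    majorantFunctional a (c • f) = c * majorantFunctional a f := by
  have hpos : ∀ {c : ℝ}, 0 ≤ c → majorantFunctional a (c • f) = c * majorantFunctional a f := by
    intro c hc
    obtain ⟨s, hs, t, ht, rfl⟩ := hf
    rw [smul_sub, majorantFunctional_sub a (smul_mem_majorizedSubharmonic hc hs)
      (smul_mem_majorizedSubharmonic hc ht), majorantFunctional_sub a hs ht,
      leastHarmonicMajorant_smul hc hs.1 hs.2, leastHarmonicMajorant_smul hc ht.1 ht.2]
    simp only [Pi.smul_apply, smul_eq_mul]; ring
  rcases le_total 0 c with hc | hc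
  · exact hpos hc
  · have := hpos (neg_nonneg.2 hc)
    rw [neg_smul, majorantFunctional_neg a (hf.smul c)] at this
    linarith

end Functional

theorem HardyTwo.mdifferentiable (h : HardyTwo Ω) :
    MDifferentiable 𝓘(ℂ) 𝓘(ℂ) (HardyTwo.eval Ω h) := h.2.1

theorem HInf.mdifferentiable (r : HInf Ω) : MDifferentiable 𝓘(ℂ) 𝓘(ℂ) (r : Ω → ℂ) := r.2.1

theorem HardyTwo.eval_injective : Function.Injective (HardyTwo.eval Ω) := Subtype.val_injective

theorem HardyTwo.eval_smul_apply (c : ℂ) (h : HardyTwo Ω) (x : Ω) :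
    HardyTwo.eval Ω (c • h) x = c * HardyTwo.eval Ω h x := rfl

theorem HardyTwo.eval_HInf_smul_apply (r : HInf Ω) (h : HardyTwo Ω) (x : Ω) :
    HardyTwo.eval Ω (r • h) x = (r : Ω → ℂ) x * HardyTwo.eval Ω h x := rfl

theorem HardyTwo.eval_add_apply (g h : HardyTwo Ω) (x : Ω) :
    HardyTwo.eval Ω (g + h) x = HardyTwo.eval Ω g x + HardyTwo.eval Ω h x := rfl

theorem HardyTwo.eval_sum_apply {ι : Type*} (s : Finset ι) (g : ι → HardyTwo Ω) (x : Ω) :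
    HardyTwo.eval Ω (∑ k ∈ s, g k) x = ∑ k ∈ s, HardyTwo.eval Ω (g k) x := by
  rw [map_sum, Finset.sum_apply]

/-- The square modulus of a function of `H²(Ω)`. -/
noncomputable def HardyTwo.normSq (h : HardyTwo Ω) (x : Ω) : ℝ := ‖HardyTwo.eval Ω h x‖ ^ 2

/-- The function `x ↦ conj (g x) * h x`. -/
noncomputable def HardyTwo.conjMul (g h : HardyTwo Ω) (x : Ω) : ℂ :=
  conj (HardyTwo.eval Ω g x) * HardyTwo.eval Ω h x

section Inner

variable [IsManifold 𝓘(ℂ) ω Ω]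

theorem HardyTwo.normSq_mem (h : HardyTwo Ω) : h.normSq ∈ majorizedSubharmonic Ω :=
  ⟨h.mdifferentiable.isSubharmonic_norm_sq, h.2.2⟩

/-- By polarization, `2 Re (conj g * h) = |g + h|² - |g|² - |h|²`. -/
theorem HardyTwo.isMajorizedDifference_re (g h : HardyTwo Ω) :
    IsMajorizedDifference fun x => (g.conjMul h x).re := by
  have key : (fun x => (g.conjMul h x).re)
      = (1 / 2 : ℝ) • ((g + h).normSq + -(g.normSq + h.normSq)) := by
    funext x
    simp only [conjMul, normSq, Pi.smul_apply, Pi.add_apply, Pi.neg_apply, smul_eq_mul,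
      eval_add_apply, ← Complex.normSq_eq_norm_sq, Complex.normSq_add]
    simp only [Complex.mul_re, Complex.conj_re, Complex.conj_im]
    ring
  rw [key]
  exact ((IsMajorizedDifference.of_mem (g + h).normSq_mem).add
    (IsMajorizedDifference.of_mem
      (add_mem_majorizedSubharmonic g.normSq_mem h.normSq_mem)).neg).smul _

theorem HardyTwo.isMajorizedDifference_im (g h : HardyTwo Ω) :
    IsMajorizedDifference fun x => (g.conjMul h x).im := by
  have key : (fun x => (g.conjMul h x).im) = fun x => ((Complex.I • g).conjMul h x).re := by
    funext x
    simp only [conjMul, eval_smul_apply]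
    simp
    ring
  rw [key]
  exact isMajorizedDifference_re _ _

/-- The inner product of `H²(Ω)` with basepoint `a`: the value at `conj g * h` of the functional
`s ↦ u_s(a)`, extended to complex functions. -/
noncomputable def HardyTwo.innerAt (a : Ω) (g h : HardyTwo Ω) : ℂ :=
  ⟨majorantFunctional a fun x => (g.conjMul h x).re,
    majorantFunctional a fun x => (g.conjMul h x).im⟩

variable [T2Space Ω]

theorem HardyTwo.innerAt_conj_symm (a : Ω) (g h : HardyTwo Ω) :
    conj (h.innerAt a g) = g.innerAt a h := by
  have h2 : (fun x => (g.conjMul h x).im) = -fun x => (h.conjMul g x).im := by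
    funext x; simp [conjMul]; ring
  apply Complex.ext
  · simp only [innerAt, Complex.conj_re]
    congr 1
    funext x; simp [conjMul]; ring
  · simp only [innerAt, Complex.conj_im]
    rw [h2, majorantFunctional_neg a (isMajorizedDifference_im h g)]

theorem HardyTwo.innerAt_add_left (a : Ω) (f g h : HardyTwo Ω) :
    (f + g).innerAt a h = f.innerAt a h + g.innerAt a h := by
  apply Complex.ext
  · simp only [innerAt, Complex.add_re]
    rw [← majorantFunctional_add a (isMajorizedDifference_re f h) (isMajorizedDifference_re g h)]
    congr 1
    funext x; simp [conjMul, eval_add_apply]; ring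
  · simp only [innerAt, Complex.add_im]
    rw [← majorantFunctional_add a (isMajorizedDifference_im f h) (isMajorizedDifference_im g h)]
    congr 1
    funext x; simp [conjMul, eval_add_apply]; ring

theorem HardyTwo.innerAt_smul_left (a : Ω) (c : ℂ) (g h : HardyTwo Ω) :
    (c • g).innerAt a h = conj c * g.innerAt a h := by
  have h1 := isMajorizedDifference_re g h
  have h2 := isMajorizedDifference_im g h
  apply Complex.ext
  · simp only [innerAt, Complex.mul_re, Complex.conj_re, Complex.conj_im]
    rw [neg_mul, sub_neg_eq_add, ← majorantFunctional_smul a _ h1, ← majorantFunctional_smul a _ h2,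
      ← majorantFunctional_add a (h1.smul _) (h2.smul _)]
    congr 1
    funext x; simp [conjMul, eval_smul_apply]; ring
  · simp only [innerAt, Complex.mul_im, Complex.conj_re, Complex.conj_im]
    rw [neg_mul, ← majorantFunctional_smul a _ h1, ← majorantFunctional_smul a _ h2,
      ← majorantFunctional_neg a (h1.smul _),
      ← majorantFunctional_add a (h2.smul _) (h1.smul _).neg]
    congr 1
    funext x; simp [conjMul, eval_smul_apply]; ring

/-- The square of the norm of `H²(Ω)` with basepoint `a`. -/
noncomputable def HardyTwo.normSqAt (a : Ω) (h : HardyTwo Ω) : ℝ :=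
  leastHarmonicMajorant h.normSq a

theorem HardyTwo.innerAt_self (a : Ω) (h : HardyTwo Ω) :
    h.innerAt a h = (h.normSqAt a : ℂ) := by
  apply Complex.ext
  · rw [Complex.ofReal_re, normSqAt, ← majorantFunctional_of_mem a h.normSq_mem]
    change majorantFunctional a (fun x => (h.conjMul h x).re) = _
    congr 1
    funext x
    simp [conjMul, normSq, ← Complex.normSq_eq_norm_sq, Complex.normSq_apply]
  · rw [Complex.ofReal_im, innerAt]
    have : (fun x => (h.conjMul h x).im) = 0 := by
      funext x; simp [conjMul]; ring
    simp only [this]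
    rw [majorantFunctional_of_mem a zero_mem_majorizedSubharmonic, leastHarmonicMajorant_zero]
    rfl

theorem HardyTwo.isLeast (h : HardyTwo Ω) :
    IsLeast (harmonicMajorants h.normSq) (leastHarmonicMajorant h.normSq) :=
  isLeast_leastHarmonicMajorant h.normSq_mem.1 h.normSq_mem.2

theorem HardyTwo.leastHarmonicMajorant_nonneg (h : HardyTwo Ω) :
    0 ≤ leastHarmonicMajorant h.normSq :=
  le_trans (fun _ => sq_nonneg _) h.isLeast.1.2

theorem HardyTwo.normSqAt_nonneg (a : Ω) (h : HardyTwo Ω) : 0 ≤ h.normSqAt a :=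
  h.leastHarmonicMajorant_nonneg a

theorem HardyTwo.normSqAt_le_of_mem {a : Ω} {h : HardyTwo Ω} {u : Ω → ℝ}
    (hu : u ∈ harmonicMajorants h.normSq) : h.normSqAt a ≤ u a := h.isLeast.2 hu a

theorem HardyTwo.normSqAt_HInf_smul_le (a : Ω) {r : HInf Ω} {C : ℝ}
    (hC : ∀ x, ‖(r : Ω → ℂ) x‖ ≤ C) (h : HardyTwo Ω) :
    (r • h).normSqAt a ≤ C ^ 2 * h.normSqAt a := by
  refine normSqAt_le_of_mem (u := C ^ 2 • leastHarmonicMajorant h.normSq)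
    ⟨h.isLeast.1.1.const_smul _, fun x => ?_⟩
  have h1 : ‖HardyTwo.eval Ω h x‖ ^ 2 ≤ leastHarmonicMajorant h.normSq x := h.isLeast.1.2 x
  rw [normSq, eval_HInf_smul_apply, norm_mul, mul_pow]
  exact mul_le_mul (pow_le_pow_left₀ (norm_nonneg _) (hC x) 2) h1 (sq_nonneg _) (sq_nonneg _)

variable [ConnectedSpace Ω]

theorem HardyTwo.eq_zero_of_normSqAt_eq_zero {a : Ω} {h : HardyTwo Ω} (h0 : h.normSqAt a = 0) :
    h = 0 := by
  have := h.isLeast.1.1.eq_zero_of_nonneg h.leastHarmonicMajorant_nonneg h0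
  refine eval_injective (funext fun x => ?_)
  have h1 : ‖HardyTwo.eval Ω h x‖ ^ 2 ≤ leastHarmonicMajorant h.normSq x := h.isLeast.1.2 x
  rw [this] at h1
  have h2 : ‖HardyTwo.eval Ω h x‖ ^ 2 = 0 := le_antisymm h1 (sq_nonneg _)
  simpa using h2

/-- Point evaluations are bounded on `H²(Ω)`, locally uniformly. -/
theorem HardyTwo.exists_nhds_norm_eval_sq_le (a x : Ω) : ∃ U ∈ 𝓝 x, ∃ C : ℝ, 0 ≤ C ∧
    ∀ h : HardyTwo Ω, ∀ y ∈ U, ‖HardyTwo.eval Ω h y‖ ^ 2 ≤ C * h.normSqAt a := by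
  obtain ⟨U, hU, C, hC, hh⟩ := exists_nhds_harnack a x
  exact ⟨U, hU, C, hC, fun h y hy =>
    (h.isLeast.1.2 y).trans (hh _ h.isLeast.1.1 h.leastHarmonicMajorant_nonneg y hy)⟩

/-- The inner product of `H²(Ω)` with basepoint `a`. -/
@[reducible]
noncomputable def hardyCore (a : Ω) : InnerProductSpace.Core ℂ (HardyTwo Ω) where
  inner g h := g.innerAt a h
  conj_inner_symm g h := HardyTwo.innerAt_conj_symm a g h
  re_inner_nonneg h := by
    rw [HardyTwo.innerAt_self]; exact h.normSqAt_nonneg a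
  add_left f g h := HardyTwo.innerAt_add_left a f g h
  smul_left g h c := HardyTwo.innerAt_smul_left a c g h
  definite h h0 := by
    rw [HardyTwo.innerAt_self] at h0
    exact HardyTwo.eq_zero_of_normSqAt_eq_zero (by exact_mod_cast h0)

end Inner

end HardySpace

/-! ### Hilbert modules with a valuation -/

section ValuationModules

variable {R : Type*} [Ring R]
  {H : Type*} [NormedAddCommGroup H] [InnerProductSpace ℂ H] [Module R H]
  {ordR : R → ℕ∞} {ordH : H → ℕ∞}

/-- The valuation subspace `V_k` as a linear subspace. -/
def IsHilbertModuleValuation.valuationSubmodule (hv : IsHilbertModuleValuation ordR ordH)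
    (V : Submodule ℂ H) (k : ℕ) : Submodule ℂ H where
  carrier := valuationSubspace ordH V k
  zero_mem' := ⟨V.zero_mem, by rw [(hv.eq_top_iff 0).2 rfl]; exact le_top⟩
  add_mem' := fun hx hy => ⟨V.add_mem hx.1 hy.1, (le_min hx.2 hy.2).trans (hv.add _ _)⟩
  smul_mem' := fun c x hx => ⟨V.smul_mem c hx.1, by
    rcases eq_or_ne c 0 with rfl | hc
    · rw [zero_smul, (hv.eq_top_iff 0).2 rfl]; exact le_top
    · rw [hv.complex_smul c x hc]; exact hx.2⟩

theorem IsHilbertModuleValuation.isClosed_valuationSubmodule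
    (hv : IsHilbertModuleValuation ordR ordH) {V : Submodule ℂ H} (hV : IsClosed (V : Set H))
    (k : ℕ) : IsClosed (hv.valuationSubmodule V k : Set H) :=
  hV.inter (upperSemicontinuous_iff_isClosed_preimage.1 hv.upperSemicontinuous k)

/-- `V_k = W_k ⊕ V_{k+1}`. -/
theorem IsHilbertModuleValuation.exists_homogeneousComponent_add [CompleteSpace H]
    (hv : IsHilbertModuleValuation ordR ordH) {V : Submodule ℂ H} (hV : IsClosed (V : Set H))
    {k : ℕ} {f : H} (hf : f ∈ valuationSubspace ordH V k) :
    ∃ w ∈ homogeneousComponent ordH V k, ∃ p ∈ valuationSubspace ordH V (k + 1), f = w + p := by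
  have : CompleteSpace (hv.valuationSubmodule V (k + 1)) :=
    (hv.isClosed_valuationSubmodule hV (k + 1)).completeSpace_coe
  obtain ⟨p, hp, w, hw, rfl⟩ := (hv.valuationSubmodule V (k + 1)).exists_add_mem_mem_orthogonal f
  have hpk : p ∈ hv.valuationSubmodule V k :=
    ⟨hp.1, le_trans (by exact_mod_cast Nat.le_succ k) hp.2⟩
  refine ⟨w, ⟨?_, fun g hg => (Submodule.mem_orthogonal _ _).1 hw g hg⟩, p, hp, add_comm _ _⟩
  have := (hv.valuationSubmodule V k).sub_mem hf hpk
  rwa [add_sub_cancel_left] at this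

/-- The components `W_k` span a dense subspace of `V`: a vector of `V` orthogonal to all of them lies
in every `V_k`, hence has infinite order. -/
theorem IsHilbertModuleValuation.eq_zero_of_orthogonal_homogeneousComponent [CompleteSpace H]
    (hv : IsHilbertModuleValuation ordR ordH) {V : Submodule ℂ H} (hV : IsClosed (V : Set H))
    {x : H} (hx : x ∈ V) (h : ∀ k, ∀ w ∈ homogeneousComponent ordH V k, inner ℂ w x = 0) :
    x = 0 := by
  have hk : ∀ k : ℕ, x ∈ valuationSubspace ordH V k := by
    intro k
    induction k with
    | zero => exact ⟨hx, by simp⟩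
    | succ k ih =>
      obtain ⟨w, hw, p, hp, rfl⟩ := hv.exists_homogeneousComponent_add hV ih
      have h1 := h k w hw
      rw [inner_add_right, inner_eq_zero_symm.1 (hw.2 p hp), add_zero, inner_self_eq_zero] at h1
      rwa [h1, zero_add]
  exact (hv.eq_top_iff x).1 (ENat.eq_top_iff_forall_ge.2 fun k => (hk k).2)

theorem homogeneousComponent_inner_top {m : ℕ} {s t : H} {V : Submodule ℂ H}
    (hs : s ∈ homogeneousComponent ordH ⊤ m) (ht : t ∈ valuationSubspace ordH V (m + 1)) :
    inner ℂ s t = 0 :=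
  inner_eq_zero_symm.1 (hs.2 t ⟨trivial, ht.2⟩)

theorem IsROneInvariant.isROneInner {V : Submodule ℂ H} (hinv : IsROneInvariant ordR V) :
    IsROneInner ordR ordH V := by
  intro k m r hr h hh g hg hm w hw
  refine inner_eq_zero_symm.1 (hw.2 _ ⟨V.sub_mem (hinv r hr h hh.1.1) hg, ?_⟩)
  exact_mod_cast Order.add_one_le_of_lt hm

theorem IsROneInvariant.hasFullProjection [CompleteSpace H]
    (hv : IsHilbertModuleValuation ordR ordH) {V : Submodule ℂ H} (hV : IsClosed (V : Set H))
    (hinv : IsROneInvariant ordR V) : HasFullProjection ordR ordH V := by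
  intro k m r hr h hh g hg hm
  set f := r • h - g with hf
  obtain ⟨w, hw, p, hp, hfw⟩ := hv.exists_homogeneousComponent_add hV (k := m) (f := f)
    ⟨V.sub_mem (hinv r hr h hh.1.1) hg, hm⟩
  obtain ⟨q, hq, t, ht, hfq⟩ := hv.exists_homogeneousComponent_add (V := ⊤) (k := m) (f := f)
    isClosed_univ ⟨trivial, hm⟩
  refine ⟨w, hw, q, ⟨hq, fun s hs => ?_⟩, hq, fun s hs => ?_⟩
  · rw [hfq, add_sub_cancel_left]
    exact homogeneousComponent_inner_top hs ht
  · have : w - q = t - p := by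
      rw [sub_eq_sub_iff_add_eq_add, ← hfw, add_comm t q, hfq]
    rw [this, inner_sub_right, homogeneousComponent_inner_top hs ht,
      homogeneousComponent_inner_top hs hp, sub_zero]

/-- The components `W_k` of an `R₁`-inner decomposition with the full projection property are
mapped into `V` by `R₁`. -/
theorem smul_mem_of_homogeneousComponent [CompleteSpace H]
    (hv : IsHilbertModuleValuation ordR ordH) {V : Submodule ℂ H} (hV : IsClosed (V : Set H))
    (hin : IsROneInner ordR ordH V) (hfp : HasFullProjection ordR ordH V) {r : R}
    (hr : 1 ≤ ordR r) {k : ℕ} {h : H} (hh : h ∈ homogeneousComponent ordH V k) : r • h ∈ V := by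
  have : CompleteSpace V := hV.completeSpace_coe
  obtain ⟨g, hg, f, hf, hrh⟩ := V.exists_add_mem_mem_orthogonal (r • h)
  have hfe : r • h - g = f := by rw [hrh, add_sub_cancel_left]
  suffices f = 0 by rw [hrh, this, add_zero]; exact hg
  by_contra hf0
  -- `f` is the component of `r h` orthogonal to `V`, and `m` is its finite order
  obtain ⟨m, hm⟩ := ENat.ne_top_iff_exists.1 (mt (hv.eq_top_iff f).1 hf0)
  obtain ⟨w, hw, p, ⟨-, hp1⟩, -, hp2⟩ := hfp k m r hr h hh g hg (by rw [hfe, hm])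
  have hwf : f - w ∈ valuationSubspace ordH ⊤ m :=
    (hv.valuationSubmodule ⊤ m).sub_mem ⟨trivial, hm.le⟩ ⟨trivial, hw.1.2⟩
  obtain ⟨q, hq, t, ht, hqt⟩ := hv.exists_homogeneousComponent_add (V := ⊤) isClosed_univ hwf
  have hq0 : q = 0 := by
    have h1 : inner ℂ q (f - w) = 0 := by
      rw [← sub_sub_sub_cancel_right f w p, inner_sub_right, hp2 q hq, ← hfe, hp1 q hq, sub_zero]
    rwa [hqt, inner_add_right, homogeneousComponent_inner_top hq ht, add_zero,
      inner_self_eq_zero] at h1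
  have hlt : (m : ℕ∞) < ordH (f - w) := by
    rw [hqt, hq0, zero_add]
    exact lt_of_lt_of_le (by exact_mod_cast Nat.lt_succ_self m) ht.2
  have hsub : r • h - (g + w) = f - w := by rw [hrh]; abel
  have hw0 : w = 0 := by
    have h1 := hin k m r hr h hh (g + w) (V.add_mem hg hw.1.1) (by rw [hsub]; exact hlt) w hw
    rw [hsub, inner_sub_right, (Submodule.mem_orthogonal _ _).1 hf w hw.1.1, zero_sub, neg_eq_zero,
      inner_self_eq_zero] at h1
    exact h1
  rw [hw0, sub_zero, ← hm] at hlt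
  exact lt_irrefl _ hlt

variable [Algebra ℂ R]

theorem smul_complex_smul_comm [IsScalarTower ℂ R H] (r : R) (c : ℂ) (h : H) :
    r • c • h = c • r • h := by
  rw [← smul_one_smul R c h, smul_smul, mul_smul_comm, mul_one, smul_assoc]

theorem isROneInvariant_of_isROneInner (hM : IsHilbertModule R H)
    (hv : IsHilbertModuleValuation ordR ordH) {V : Submodule ℂ H} (hV : IsClosed (V : Set H))
    (hin : IsROneInner ordR ordH V) (hfp : HasFullProjection ordR ordH V) :
    IsROneInvariant ordR V := by
  have := hM.complete
  have := hM.scalarTower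
  intro r hr h hh
  -- the closed subspace of the vectors of `V` which `r` maps into `V` contains every `W_k`
  let X : Submodule ℂ H :=
    { carrier := {x | x ∈ V ∧ r • x ∈ V}
      zero_mem' := ⟨V.zero_mem, by rw [smul_zero]; exact V.zero_mem⟩
      add_mem' := fun hx hy => ⟨V.add_mem hx.1 hy.1, by
        rw [smul_add]; exact V.add_mem hx.2 hy.2⟩
      smul_mem' := fun c x hx => ⟨V.smul_mem c hx.1, by
        rw [smul_complex_smul_comm]; exact V.smul_mem c hx.2⟩ }
  have hX : IsClosed (X : Set H) := hV.inter (hV.preimage (hM.continuous_smul r))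
  have : CompleteSpace X := hX.completeSpace_coe
  obtain ⟨y, hy, z, hz, rfl⟩ := X.exists_add_mem_mem_orthogonal h
  have hzV : z ∈ V := by
    have := V.sub_mem hh hy.1
    rwa [add_sub_cancel_left] at this
  have hz0 : z = 0 := hv.eq_zero_of_orthogonal_homogeneousComponent hV hzV fun k w hw =>
    (Submodule.mem_orthogonal _ _).1 hz w
      ⟨hw.1.1, smul_mem_of_homogeneousComponent hv hV hin hfp hr hw⟩
  rw [hz0, add_zero]
  exact hy.2

theorem isRInvariant_iff_isROneInvariant (hM : IsHilbertModule R H) (hu : IsUnitalValuation ordR)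
    (V : Submodule ℂ H) : IsRInvariant R V ↔ IsROneInvariant ordR V := by
  have := hM.scalarTower
  refine ⟨fun h r _ => h r, fun h r x hx => ?_⟩
  obtain ⟨c, s, hs, rfl⟩ := hu r
  rw [add_smul, smul_assoc, one_smul]
  exact V.add_mem (V.smul_mem c hx) (h s hs x hx)

/-- A closed subspace of a Hilbert module with a valuation is `R₁`-invariant if and only if its
homogeneous decomposition is `R₁`-inner and has the full projection property. -/
theorem isROneInvariant_iff (hM : IsHilbertModule R H) (hv : IsHilbertModuleValuation ordR ordH)
    {V : Submodule ℂ H} (hV : IsClosed (V : Set H)) :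
    IsROneInvariant ordR V ↔ IsROneInner ordR ordH V ∧ HasFullProjection ordR ordH V :=
  have := hM.complete
  ⟨fun h => ⟨h.isROneInner, h.hasFullProjection hv hV⟩,
    fun h => isROneInvariant_of_isROneInner hM hv hV h.1 h.2⟩

end ValuationModules

/-! ### H² as an analytic Hilbert module -/

section Completeness

open Metric Set Filter Topology

/-- The Cauchy–Schwarz inequality for series, with separate weights. -/
theorem norm_tsum_sq_le_of_norm_sq_le_mul {b : ℕ → ℂ} {c v : ℕ → ℝ} (hc : ∀ k, 0 ≤ c k)
    (hv : ∀ k, 0 ≤ v k) (h : ∀ k, ‖b k‖ ^ 2 ≤ c k * v k) (hcs : Summable c) (hvs : Summable v) :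
    Summable b ∧ ‖∑' k, b k‖ ^ 2 ≤ (∑' k, c k) * ∑' k, v k := by
  have hb : Summable b := by
    refine Summable.of_norm_bounded ((hcs.add hvs).div_const 2) fun k => ?_
    refine abs_le_of_sq_le_sq' (a := ‖b k‖) ?_ ?_ |>.2
    · nlinarith [h k, sq_nonneg (c k - v k)]
    · linarith [hc k, hv k]
  refine ⟨hb, le_of_tendsto ((hb.hasSum.tendsto_sum_nat).norm.pow 2)
    (Eventually.of_forall fun n => ?_)⟩
  calc ‖∑ k ∈ Finset.range n, b k‖ ^ 2 ≤ (∑ k ∈ Finset.range n, ‖b k‖) ^ 2 :=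
        pow_le_pow_left₀ (norm_nonneg _) (norm_sum_le _ _) 2
    _ ≤ (∑ k ∈ Finset.range n, c k) * ∑ k ∈ Finset.range n, v k :=
        Finset.sum_sq_le_sum_mul_sum_of_sq_le_mul _ (fun k _ => hc k) (fun k _ => hv k)
          fun k _ => h k
    _ ≤ _ := mul_le_mul (hcs.sum_le_tsum _ fun k _ => hc k) (hvs.sum_le_tsum _ fun k _ => hv k)
        (Finset.sum_nonneg fun k _ => hv k) (tsum_nonneg hc)

variable {Ω : Type*} [TopologicalSpace Ω] [ChartedSpace ℂ Ω] [IsManifold 𝓘(ℂ) ω Ω]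

theorem mdifferentiable_tsum_of_locally_bounded {f : ℕ → Ω → ℂ}
    (hf : ∀ k, MDifferentiable 𝓘(ℂ) 𝓘(ℂ) (f k))
    (hb : ∀ x, ∃ U ∈ 𝓝 x, ∃ c : ℕ → ℝ, Summable c ∧ ∀ k, ∀ y ∈ U, ‖f k y‖ ≤ c k) :
    MDifferentiable 𝓘(ℂ) 𝓘(ℂ) fun x => ∑' k, f k x := by
  refine mdifferentiable_of_differentiableAt_chart fun x => ?_
  obtain ⟨U, hU, c, hc, hle⟩ := hb x
  obtain ⟨R, hD, hDU⟩ := exists_isChartDisc hU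
  have := Complex.differentiableOn_tsum_of_summable_norm
    (F := fun k => f k ∘ (chartAt ℂ x).symm) hc
    (fun k => ((hf k).analyticOnNhd_comp_chart_symm hD.mem_atlas).differentiableOn.mono
      (ball_subset_closedBall.trans hD.subset_target)) isOpen_ball
    (fun k z hz => hle k _ (hDU z (ball_subset_closedBall hz)))
  exact this.differentiableAt (isOpen_ball.mem_nhds (mem_ball_self hD.pos))

theorem isAnalyticAlgebra_HInf [ConnectedSpace Ω] (a : Ω) : IsAnalyticAlgebra a (HInf Ω) where
  analytic r := (HInf.mdifferentiable r)
  valuation :=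
    { unit := fun r s hrs => by
        have h1 : (r : Ω → ℂ) a * (s : Ω → ℂ) a = 1 := congrFun (congrArg Subtype.val hrs) a
        exact ⟨zeroOrder_eq_zero_of_ne (left_ne_zero_of_mul_eq_one h1),
          zeroOrder_eq_zero_of_ne (right_ne_zero_of_mul_eq_one h1)⟩
      eq_top_iff := fun r => by
        rw [(HInf.mdifferentiable r).zeroOrder_eq_top_iff a]
        exact ZeroMemClass.coe_eq_zero
      mul := fun r s => (zeroOrder_mul (HInf.mdifferentiable r) (HInf.mdifferentiable s) a).ge
      smul := fun c r hc => zeroOrder_const_smul (HInf.mdifferentiable r) a hc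
      add := fun r s => min_le_zeroOrder_add a _ _ }

theorem isUnitalValuation_HInf (a : Ω) :
    IsUnitalValuation fun r : HInf Ω => zeroOrder a (r : Ω → ℂ) := fun r => by
  refine ⟨(r : Ω → ℂ) a, r - (r : Ω → ℂ) a • 1, ?_, by abel⟩
  exact one_le_zeroOrder (HInf.mdifferentiable _) (by simp)

variable [T2Space Ω] [ConnectedSpace Ω]

/-- The completeness of `H²(Ω)`: a series of functions with summable norms converges. If
`c k = ‖g k‖` and `v k` is the least harmonic majorant of `|g k|²` divided by `c k`, then
`(∑ c k) (∑ v k)` is a harmonic majorant of `|∑ g k|²`, and likewise for the remainders. -/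
theorem HardyTwo.exists_sum_of_summable {a : Ω} {g : ℕ → HardyTwo Ω} {c : ℕ → ℝ}
    (hc : ∀ k, 0 ≤ c k) (hg : ∀ k, (g k).normSqAt a = c k ^ 2) (hcs : Summable c) :
    ∃ h : HardyTwo Ω, ∀ n,
      (h - ∑ k ∈ Finset.range n, g k).normSqAt a ≤ (∑' k, c (k + n)) ^ 2 := by
  -- where `c k = 0`, also `g k = 0`, and the value `0⁻¹ = 0` makes `v k` vanish
  let v : ℕ → Ω → ℝ := fun k => (c k)⁻¹ • leastHarmonicMajorant (g k).normSq
  have hvh : ∀ k, IsHarmonic (v k) := fun k => (g k).isLeast.1.1.const_smul _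
  have hv0 : ∀ k, 0 ≤ v k := fun k => smul_nonneg (inv_nonneg.2 (hc k))
    (g k).leastHarmonicMajorant_nonneg
  have hva : ∀ k, v k a = c k := fun k => by
    change (c k)⁻¹ * (g k).normSqAt a = c k
    rw [hg, sq, ← mul_assoc]
    rcases eq_or_ne (c k) 0 with h | h
    · simp [h]
    · rw [inv_mul_cancel₀ h, one_mul]
  have hgv : ∀ k x, ‖HardyTwo.eval Ω (g k) x‖ ^ 2 ≤ c k * v k x := fun k x => by
    rcases eq_or_ne (c k) 0 with h | h
    · have : g k = 0 := eq_zero_of_normSqAt_eq_zero (a := a) (by rw [hg, h]; simp)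
      simp [this, h]
    · change _ ≤ c k * ((c k)⁻¹ * leastHarmonicMajorant (g k).normSq x)
      rw [mul_inv_cancel_left₀ h]
      exact (g k).isLeast.1.2 x
  have hcn : ∀ n, Summable fun k => c (k + n) := fun n => (summable_nat_add_iff n).2 hcs
  have hV := fun n => isHarmonic_tsum_of_nonneg (a := a) (fun k => hvh (k + n))
    (fun k => hv0 (k + n)) (by simpa only [hva] using hcn n)
  have hcs' := fun n x => norm_tsum_sq_le_of_norm_sq_le_mul (fun k => hc (k + n))
    (fun k => hv0 (k + n) x) (fun k => hgv (k + n) x) (hcn n) ((hV n).1 x)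
  have hmaj : ∀ n, IsHarmonic ((∑' k, c (k + n)) • fun x => ∑' k, v (k + n) x) :=
    fun n => (hV n).2.const_smul _
  have hmd : MDifferentiable 𝓘(ℂ) 𝓘(ℂ) fun x => ∑' k, HardyTwo.eval Ω (g k) x := by
    refine mdifferentiable_tsum_of_locally_bounded (fun k => (g k).mdifferentiable) fun x => ?_
    obtain ⟨U, hU, C, hC, h⟩ := exists_nhds_norm_eval_sq_le a x
    refine ⟨U, hU, fun k => √C * c k, hcs.mul_left _, fun k y hy => ?_⟩
    refine abs_le_of_sq_le_sq' (a := ‖HardyTwo.eval Ω (g k) y‖) ?_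
      (mul_nonneg (Real.sqrt_nonneg _) (hc k)) |>.2
    rw [mul_pow, Real.sq_sqrt hC, ← hg]
    exact h (g k) y hy
  let h : HardyTwo Ω := ⟨fun x => ∑' k, HardyTwo.eval Ω (g k) x, hmd, _, hmaj 0,
    fun x => (hcs' 0 x).2⟩
  refine ⟨h, fun n => ?_⟩
  have htail : ∀ x, HardyTwo.eval Ω (h - ∑ k ∈ Finset.range n, g k) x
      = ∑' k, HardyTwo.eval Ω (g (k + n)) x := fun x => by
    rw [map_sub, Pi.sub_apply, eval_sum_apply, sub_eq_iff_eq_add']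
    exact ((hcs' 0 x).1.sum_add_tsum_nat_add n).symm
  refine (normSqAt_le_of_mem ⟨hmaj n, fun x => ?_⟩).trans (le_of_eq ?_)
  · rw [normSq, htail]
    exact (hcs' n x).2
  · simp only [Pi.smul_apply, hva, smul_eq_mul, sq]

theorem hardyTwo_norm_sq (a : Ω) (h : HardyTwo Ω) :
    letI : NormedAddCommGroup (HardyTwo Ω) := (hardyCore a).toNormedAddCommGroup
    ‖h‖ ^ 2 = h.normSqAt a := by
  change √(RCLike.re (h.innerAt a h)) ^ 2 = _
  rw [h.innerAt_self a]
  exact Real.sq_sqrt (h.normSqAt_nonneg a)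

theorem hardyTwo_completeSpace (a : Ω) :
    letI : NormedAddCommGroup (HardyTwo Ω) := (hardyCore a).toNormedAddCommGroup
    CompleteSpace (HardyTwo Ω) := by
  let : NormedAddCommGroup (HardyTwo Ω) := (hardyCore a).toNormedAddCommGroup
  refine NormedAddCommGroup.completeSpace_of_summable_imp_tendsto fun g hg => ?_
  obtain ⟨h, hh⟩ := HardyTwo.exists_sum_of_summable (a := a) (fun k => norm_nonneg (g k))
    (fun k => (hardyTwo_norm_sq a (g k)).symm) hg
  refine ⟨h, tendsto_iff_norm_sub_tendsto_zero.2 ?_⟩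
  refine squeeze_zero (fun _ => norm_nonneg _) (fun n => ?_)
    (tendsto_sum_nat_add fun k => ‖g k‖)
  rw [norm_sub_rev]
  refine abs_le_of_sq_le_sq' (a := ‖h - ∑ k ∈ Finset.range n, g k‖) ?_
    (tsum_nonneg fun k => norm_nonneg _) |>.2
  rw [hardyTwo_norm_sq]
  exact hh n

/-- Norm convergence in `H²(Ω)` implies uniform convergence on compact sets. -/
theorem hardyTwo_tendstoUniformlyOn (a : Ω) :
    letI : NormedAddCommGroup (HardyTwo Ω) := (hardyCore a).toNormedAddCommGroup
    ∀ (f : ℕ → HardyTwo Ω) (h : HardyTwo Ω), Tendsto f atTop (𝓝 h) → ∀ K : Set Ω, IsCompact K →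
      TendstoUniformlyOn (fun n => HardyTwo.eval Ω (f n)) (HardyTwo.eval Ω h) atTop K := by
  let : NormedAddCommGroup (HardyTwo Ω) := (hardyCore a).toNormedAddCommGroup
  intro f h hfh K hK
  have hloc : TendstoLocallyUniformlyOn (fun n => HardyTwo.eval Ω (f n)) (HardyTwo.eval Ω h)
      atTop K := by
    refine tendstoLocallyUniformlyOn_iff.2 fun ε hε x _ => ?_
    obtain ⟨U, hU, C, hC, hle⟩ := HardyTwo.exists_nhds_norm_eval_sq_le a x
    refine ⟨U, nhdsWithin_le_nhds hU, ?_⟩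
    have h1 : Tendsto (fun n => √C * ‖f n - h‖) atTop (𝓝 0) := by
      simpa using (tendsto_iff_norm_sub_tendsto_zero.1 hfh).const_mul (√C)
    filter_upwards [h1.eventually_lt_const hε] with n hn y hy
    rw [dist_eq_norm, norm_sub_rev, ← Pi.sub_apply, ← map_sub]
    refine lt_of_le_of_lt ?_ hn
    refine abs_le_of_sq_le_sq' (a := ‖HardyTwo.eval Ω (f n - h) y‖) ?_ (by positivity) |>.2
    rw [mul_pow, Real.sq_sqrt hC, hardyTwo_norm_sq]
    exact hle _ y hy
  exact (tendstoLocallyUniformlyOn_iff_tendstoUniformlyOn_of_compact hK).1 hloc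

theorem hardyTwo_continuous_smul (a : Ω) (r : HInf Ω) :
    letI : NormedAddCommGroup (HardyTwo Ω) := (hardyCore a).toNormedAddCommGroup
    Continuous fun h : HardyTwo Ω => r • h := by
  let : NormedAddCommGroup (HardyTwo Ω) := (hardyCore a).toNormedAddCommGroup
  obtain ⟨C, hC⟩ := r.2.2
  have hC0 : 0 ≤ C := (norm_nonneg _).trans (hC a)
  refine AddMonoidHomClass.continuous_of_bound (DistribSMul.toAddMonoidHom (HardyTwo Ω) r) C
    fun h => ?_
  refine abs_le_of_sq_le_sq' (a := ‖r • h‖) ?_ (by positivity) |>.2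
  rw [mul_pow, hardyTwo_norm_sq, hardyTwo_norm_sq]
  exact h.normSqAt_HInf_smul_le a hC

theorem upperSemicontinuous_zeroOrder_hardyTwo (a : Ω) :
    letI : NormedAddCommGroup (HardyTwo Ω) := (hardyCore a).toNormedAddCommGroup
    UpperSemicontinuous fun h : HardyTwo Ω => zeroOrder a (HardyTwo.eval Ω h) := by
  let : NormedAddCommGroup (HardyTwo Ω) := (hardyCore a).toNormedAddCommGroup
  have hcl : ∀ k : ℕ, IsClosed {h : HardyTwo Ω | (k : ℕ∞) ≤ zeroOrder a (HardyTwo.eval Ω h)} := by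
    intro k
    refine IsSeqClosed.isClosed fun f h hf hfh => ?_
    obtain ⟨R, hD, -⟩ := exists_isChartDisc (x := a) univ_mem
    have hK := (isCompact_closedBall _ R).image_of_continuousOn
      ((chartAt ℂ a).continuousOn_symm.mono hD.subset_target)
    refine le_zeroOrder_of_tendstoUniformlyOn (fun n => (f n).mdifferentiable) h.mdifferentiable
      ?_ (hardyTwo_tendstoUniformlyOn a f h hfh _ hK) hf
    have ha := mem_chart_source ℂ a
    have : (chartAt ℂ a).source ∩ (chartAt ℂ a) ⁻¹' ball (chartAt ℂ a a) R ∈ 𝓝 a :=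
      inter_mem ((chartAt ℂ a).open_source.mem_nhds ha)
        (((chartAt ℂ a).continuousAt ha).preimage_mem_nhds (ball_mem_nhds _ hD.pos))
    refine mem_of_superset this fun y hy => ⟨chartAt ℂ a y, ball_subset_closedBall hy.2, ?_⟩
    exact (chartAt ℂ a).left_inv hy.1
  refine upperSemicontinuous_iff_isClosed_preimage.2 fun y => ?_
  induction y using ENat.recTopCoe with
  | coe k => exact hcl k
  | top =>
    have : (fun h : HardyTwo Ω => zeroOrder a (HardyTwo.eval Ω h)) ⁻¹' Ici ⊤
        = ⋂ k : ℕ, {h : HardyTwo Ω | (k : ℕ∞) ≤ zeroOrder a (HardyTwo.eval Ω h)} := by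
      ext h
      simp only [mem_preimage, mem_Ici, top_le_iff, mem_iInter, mem_ofPred_eq]
      exact ENat.eq_top_iff_forall_ge
    rw [this]
    exact isClosed_iInter hcl

theorem isHilbertModule_hardyTwo (a : Ω) :
    letI : NormedAddCommGroup (HardyTwo Ω) := (hardyCore a).toNormedAddCommGroup
    letI : InnerProductSpace ℂ (HardyTwo Ω) := InnerProductSpace.ofCore (hardyCore a).toCore
    IsHilbertModule (HInf Ω) (HardyTwo Ω) :=
  letI : NormedAddCommGroup (HardyTwo Ω) := (hardyCore a).toNormedAddCommGroup
  letI : InnerProductSpace ℂ (HardyTwo Ω) := InnerProductSpace.ofCore (hardyCore a).toCore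
  { complete := hardyTwo_completeSpace a
    scalarTower := ⟨fun c r h => HardyTwo.eval_injective (funext fun x =>
      mul_assoc c ((r : Ω → ℂ) x) (HardyTwo.eval Ω h x))⟩
    continuous_smul := hardyTwo_continuous_smul a }

theorem isAnalyticHilbertModule_hardyTwo (a : Ω) :
    letI : NormedAddCommGroup (HardyTwo Ω) := (hardyCore a).toNormedAddCommGroup
    letI : InnerProductSpace ℂ (HardyTwo Ω) := InnerProductSpace.ofCore (hardyCore a).toCore
    IsAnalyticHilbertModule a (HInf Ω) (HardyTwo.eval Ω) :=
  letI : NormedAddCommGroup (HardyTwo Ω) := (hardyCore a).toNormedAddCommGroup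
  letI : InnerProductSpace ℂ (HardyTwo Ω) := InnerProductSpace.ofCore (hardyCore a).toCore
  { analyticAlgebra := isAnalyticAlgebra_HInf a
    injective := HardyTwo.eval_injective
    analytic := HardyTwo.mdifferentiable
    hilbertModule := isHilbertModule_hardyTwo a
    valuation :=
      { eq_top_iff := fun h => by
          rw [h.mdifferentiable.zeroOrder_eq_top_iff a]
          exact map_eq_zero_iff (HardyTwo.eval Ω) HardyTwo.eval_injective
        smul := fun r h => (zeroOrder_mul (HInf.mdifferentiable r) h.mdifferentiable a).ge
        complex_smul := fun c h hc => zeroOrder_const_smul h.mdifferentiable a hc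
        add := fun g h => by
          rw [map_add]; exact min_le_zeroOrder_add a _ _
        upperSemicontinuous := upperSemicontinuous_zeroOrder_hardyTwo a }
    uniform_on_compacts := ⟨univ, isOpen_univ, mem_univ a, fun f h hfh K _ hK =>
      hardyTwo_tendstoUniformlyOn a f h hfh K hK⟩ }

end Completeness

theorem theorem14p10 {Ω : Type*} [TopologicalSpace Ω] [T2Space Ω] [ConnectedSpace Ω]
    [ChartedSpace ℂ Ω] [IsManifold 𝓘(ℂ) ω Ω] (a : Ω) :
    ∃ core : InnerProductSpace.Core ℂ (HardyTwo Ω),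
      letI : NormedAddCommGroup (HardyTwo Ω) := core.toNormedAddCommGroup
      letI : InnerProductSpace ℂ (HardyTwo Ω) := InnerProductSpace.ofCore core.toCore
      let ordR : HInf Ω → ℕ∞ := fun r => zeroOrder a (r : Ω → ℂ)
      let ordH : HardyTwo Ω → ℕ∞ := fun h => zeroOrder a (HardyTwo.eval Ω h)
      (∀ h : HardyTwo Ω, ∃ u : Ω → ℝ,
        IsLeast (harmonicMajorants fun x => ‖HardyTwo.eval Ω h x‖ ^ 2) u ∧ ‖h‖ ^ 2 = u a) ∧
      IsAnalyticHilbertModule a (HInf Ω) (HardyTwo.eval Ω) ∧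
      IsUnitalValuation ordR ∧
      ∀ V : Submodule ℂ (HardyTwo Ω), IsClosed (V : Set (HardyTwo Ω)) →
        (IsROneInvariant ordR V ↔ IsROneInner ordR ordH V ∧ HasFullProjection ordR ordH V) ∧
        (IsRInvariant (HInf Ω) V ↔ IsROneInner ordR ordH V ∧ HasFullProjection ordR ordH V) := by
  refine ⟨hardyCore a, ?_⟩
  let : NormedAddCommGroup (HardyTwo Ω) := (hardyCore a).toNormedAddCommGroup
  let : InnerProductSpace ℂ (HardyTwo Ω) := InnerProductSpace.ofCore (hardyCore a).toCore
  intro ordR ordH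
  have hM := isAnalyticHilbertModule_hardyTwo a
  have hu : IsUnitalValuation ordR := isUnitalValuation_HInf a
  refine ⟨fun h => ⟨_, h.isLeast, hardyTwo_norm_sq a h⟩, hM, hu, fun V hV => ?_⟩
  have key := isROneInvariant_iff hM.hilbertModule hM.valuation hV
  exact ⟨key, (isRInvariant_iff_isROneInvariant hM.hilbertModule hu V).trans key⟩
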